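/- For $d\ge 1$ let $N_d$ be the group of $(d+1)\times(d+1)$ lower-triangular integer matrices with all diagonal entries equal to $1$. It acts on $\mathbb{Z}^d$ by $f\cdot(i_1,\dots,i_d)=(j_1,\dots,j_d)$, where $f(1,i_1,\dots,i_d)^T=(1,j_1,\dots,j_d)^T$. A \emph{Farb--Franks action} of $N_d$ is an action $\phi$ of $N_d$ on $[0,1]$ by orientation-preserving homeomorphisms for which there are closed intervals $I_i\subset[0,1]$ ($i\in\mathbb{Z}^d$) of positive lengths with total length $1$, placed next to each other on $[0,1]$ in the lexicographic order of $\mathbb{Z}^d$, such that $\phi(f)(I_i)=I_{f\cdot i}$ for all $f\in N_d$ and $i\in\mathbb{Z}^d$, and such that the maps between these intervals are equivariant, i.e. $\phi(f)|_{I_i}=\phi(g)|_{I_i}$ whenever $f\cdot i=g\cdot i$. (All such actions are topologically conjugate to each other; $\phi_{FF}$, the action constructed by Farb and Franks, is one of them.) Theorem B. Let $d\ge 2$ and $0<\alpha<\frac{2}{d(d-1)}$. Then Farb--Franks actions of $N_d$ exist, and every Farb--Franks action of $N_d$ (in particular $\phi_{FF}$) is topologically conjugate to an action of $N_d$ on $[0,1]$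 by orientation-preserving $C^{1+\alpha}$ diffeomorphisms, that is, $C^1$ diffeomorphisms $h$ of $[0,1]$ for which there is a constant $M$ with $|h'(x)-h'(y)|\le M|x-y|^\alpha$ for all $x,y\in[0,1]$. -/

import Mathlib

/-- `N_d`: the group of `(d+1) × (d+1)` lower-triangular integer matrices all of whose diagonal
entries are `1` (realized inside `SL(d+1, ℤ)`). -/
def lowerUnitriangular (d : ℕ) : Subgroup (Matrix.SpecialLinearGroup (Fin (d + 1)) ℤ) where
  carrier := {A | (∀ i, A.1 i i = 1) ∧ ∀ i j, i < j → A.1 i j = 0}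
  one_mem' := by
    refine ⟨fun i => by simp, fun i j hij => ?_⟩
    simp [hij.ne]
  mul_mem' := by
    rintro A B ⟨hA1, hA0⟩ ⟨hB1, hB0⟩
    refine ⟨fun i => ?_, fun i j hij => ?_⟩
    · rw [Matrix.SpecialLinearGroup.coe_mul, Matrix.mul_apply, Finset.sum_eq_single i]
      · rw [hA1, hB1, one_mul]
      · intro k _ hk
        rcases lt_or_gt_of_ne hk with h | h
        · rw [hB0 k i h, mul_zero]
        · rw [hA0 i k h, zero_mul]
      · simp
    · rw [Matrix.SpecialLinearGroup.coe_mul, Matrix.mul_apply]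
      refine Finset.sum_eq_zero fun k _ => ?_
      rcases lt_or_ge i k with h | h
      · rw [hA0 i k h, zero_mul]
      · rw [hB0 k j (lt_of_le_of_lt h hij), mul_zero]
  inv_mem' := by
    rintro A ⟨hA1, hA0⟩
    have hmul : A.1 * (A⁻¹).1 = 1 := by
      rw [← Matrix.SpecialLinearGroup.coe_mul, mul_inv_cancel, Matrix.SpecialLinearGroup.coe_one]
    have key : ∀ i j : Fin (d + 1), i ≤ j →
        (A⁻¹).1 i j = (1 : Matrix (Fin (d + 1)) (Fin (d + 1)) ℤ) i j := by
      intro i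
      induction i using WellFoundedLT.induction with
      | _ i ih =>
        intro j hij
        have h := congrFun (congrFun hmul i) j
        rw [Matrix.mul_apply, Finset.sum_eq_single i] at h
        · rwa [hA1, one_mul] at h
        · intro k _ hk
          rcases lt_or_gt_of_ne hk with hki | hki
          · rw [ih k hki j (hki.le.trans hij), Matrix.one_apply_ne (hki.trans_le hij).ne, mul_zero]
          · rw [hA0 i k hki, zero_mul]
        · simp
    exact ⟨fun i => by rw [key i i le_rfl, Matrix.one_apply_eq],
      fun i j hij => by rw [key i j hij.le, Matrix.one_apply_ne hij.ne]⟩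

namespace FarbFranks

/-- The action of `N_d` on `ℤ^d` induced by the linear action on the affine hyperplane
`1 × ℤ^d` of `ℤ^{d+1}`: `f (1, i_1, …, i_d)ᵀ = (1, j_1, …, j_d)ᵀ`. -/
def act {d : ℕ} (f : lowerUnitriangular d) (i : Fin d → ℤ) : Fin d → ℤ :=
  fun k => f.1.1.mulVec (Fin.cons 1 i : Fin (d + 1) → ℤ) k.succ

/-- The left endpoint of the interval `I_i` when intervals of lengths `ℓ` are joined
lexicographically, starting at `0`. -/
noncomputable def leftEnd {d : ℕ} (ℓ : (Fin d → ℤ) → ℝ) (i : Fin d → ℤ) : ℝ :=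
  ∑' j : {j : Fin d → ℤ // toLex j < toLex i}, ℓ j.1

/-- The closed subinterval `I_i` of `[0,1]`, of length `ℓ i`. -/
def block {d : ℕ} (ℓ : (Fin d → ℤ) → ℝ) (i : Fin d → ℤ) : Set unitInterval :=
  {x | leftEnd ℓ i ≤ (x : ℝ) ∧ (x : ℝ) ≤ leftEnd ℓ i + ℓ i}

/-- `φ` is a Farb-Franks action of `N_d` on `[0,1]`: it acts by orientation-preserving
homeomorphisms, and there are closed intervals `I_i` (`i ∈ ℤ^d`) of positive lengths with total
length `1`, joined lexicographically on `[0,1]`, such that every `f ∈ N_d` sends `I_i` onto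
`I_{f i}`, and does so equivariantly: the map `I → J` between two of the intervals depends only
on `I` and `J`, not on the group element inducing it. -/
def IsFarbFranksAction (d : ℕ) (φ : lowerUnitriangular d →* (unitInterval ≃ₜ unitInterval)) :
    Prop :=
  (∀ f, StrictMono (φ f)) ∧
  ∃ ℓ : (Fin d → ℤ) → ℝ, (∀ i, 0 < ℓ i) ∧ HasSum ℓ 1 ∧
    (∀ f i, φ f '' block ℓ i = block ℓ (act f i)) ∧
    ∀ f g i, act f i = act g i → Set.EqOn (φ f) (φ g) (block ℓ i)

/-- `h` is an orientation-preserving `C^{1+α}` diffeomorphism of `[0,1]`: it has at every point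
of `[0,1]` (one-sided at the endpoints) a positive derivative, which is `α`-Hölder on `[0,1]`.
The inverse of such a map is again differentiable, the derivative having no zeros. -/
def IsC1HolderDiffeo (α : ℝ) (h : unitInterval ≃ₜ unitInterval) : Prop :=
  ∃ h' : unitInterval → ℝ,
    (∀ x : unitInterval, 0 < h' x ∧
      HasDerivWithinAt (fun t : ℝ => (h (Set.projIcc 0 1 zero_le_one t) : ℝ)) (h' x)
        (Set.Icc 0 1) (x : ℝ)) ∧
    ∃ M : ℝ, ∀ x y : unitInterval, |h' x - h' y| ≤ M * |(x : ℝ) - (y : ℝ)| ^ α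

/-- Two actions on `[0,1]` are topologically conjugate. -/
def TopConj {G : Type*} [Group G] (φ ψ : G →* (unitInterval ≃ₜ unitInterval)) : Prop :=
  ∃ h : unitInterval ≃ₜ unitInterval, ∀ g x, h (φ g x) = ψ g (h x)

end FarbFranks

namespace FarbFranks

open MeasureTheory Set Filter Topology

/-! ### The affine action on `ℤ^d` -/

section Action

variable {d : ℕ}

/-! Write d = n + 1 and index the blocks by (v, j) with v in ℤ^n and j in ℤ. If block (v, j) is
identified with {v} × [j, j + 1], every Farb–Franks action becomes, on a dense subset of [0,1], the
skew product (v, t) ↦ (`baseAct f v`, t + `shift f v`) on ℤ^n × ℝ in lexicographic order: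
equivariance allows one parametrization of the block of 0 to be carried to all blocks consistently
(`IsFarbFranksAction.exists_isLexEmbedding`). Conversely, the skew product extends to an action on
[0,1] along any lexicographic embedding with dense range (`extendHom`), which gives existence.

To conjugate, choose a probability density on ℤ^n × ℝ and let the new coordinate of a point be the
mass to its left. The skew product preserves counting times Lebesgue measure, so the derivative of
the conjugated map is the ratio of the densities at the image and at the point
(`isC1HolderDiffeo_conj`). The density is proportional to (t² + a²)^(-m), where a = r^s and r is the
weighted size `level v`. A group element changes r by O(1) and translates the line over v by O(r^n);
for s ≥ n + 1 the ratio is therefore 1 + O(1/r), and it tends to 1 at both ends of the line.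

The mass of the line over v is of order a^(1-2m), and m is chosen to make this r^(-1/α). The
oscillation 1/r of the ratio is then of order mass^α; interpolating it with a derivative bound gives
a Hölder constant independent of v (`abs_densityRatio_sub_le`), and extending the ratio by 1 glues
the lines (`exists_holder_extension`). The total mass is finite as soon as 1/α > 1 + … + n = d(d -
1)/2 (`summable_level_rpow`), which is the hypothesis on α. -/

theorem cons_act (f : lowerUnitriangular d) (i : Fin d → ℤ) :
    (Fin.cons 1 (act f i) : Fin (d + 1) → ℤ) = f.1.1.mulVec (Fin.cons 1 i) := by
  funext k
  refine Fin.cases ?_ (fun k => ?_) k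
  · rw [Fin.cons_zero, Matrix.mulVec, dotProduct, Fin.sum_univ_succ]
    rw [Finset.sum_eq_zero fun l _ => by rw [f.2.2 0 l.succ l.succ_pos, zero_mul]]
    simp [f.2.1 0]
  · rw [Fin.cons_succ]; rfl

theorem act_mul (f g : lowerUnitriangular d) (i : Fin d → ℤ) :
    act (f * g) i = act f (act g i) := by
  have h : (Fin.cons 1 (act (f * g) i) : Fin (d + 1) → ℤ) = Fin.cons 1 (act f (act g i)) := by
    rw [cons_act, cons_act, cons_act, Matrix.mulVec_mulVec]
    rfl
  exact Fin.cons_right_injective _ h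

theorem act_one (i : Fin d → ℤ) : act (1 : lowerUnitriangular d) i = i := by
  have h : (Fin.cons 1 (act (1 : lowerUnitriangular d) i) : Fin (d + 1) → ℤ) = Fin.cons 1 i := by
    rw [cons_act]
    exact Matrix.one_mulVec _
  exact Fin.cons_right_injective _ h

theorem act_eq_add (f : lowerUnitriangular d) (i : Fin d → ℤ) (k : Fin d) :
    act f i k = i k + f.1.1 k.succ 0 +
      ∑ l ∈ Finset.univ.filter (· < k), f.1.1 k.succ l.succ * i l := by
  rw [act, Matrix.mulVec, dotProduct, Fin.sum_univ_succ]
  simp only [Fin.cons_zero, mul_one, Fin.cons_succ]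
  rw [← Finset.sum_filter_add_sum_filter_not _ (· < k)]
  have h : ∑ l ∈ Finset.univ.filter (fun l => ¬ l < k), f.1.1 k.succ l.succ * i l = i k := by
    rw [Finset.sum_eq_single k]
    · rw [f.2.1, one_mul]
    · intro l hl hlk
      have hl' : k < l := lt_of_le_of_ne (not_lt.1 (Finset.mem_filter.1 hl).2) (Ne.symm hlk)
      rw [f.2.2 _ _ (Fin.succ_lt_succ_iff.2 hl'), zero_mul]
    · simp
  rw [h]
  ring

theorem toLex_lt_iff {i j : Fin d → ℤ} :
    toLex i < toLex j ↔ ∃ k, (∀ l < k, i l = j l) ∧ i k < j k := Iff.rfl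

/-- The displacement of a coordinate depends only on the earlier ones, so up to and including the
first difference both points are translated equally. -/
theorem act_lt_act (f : lowerUnitriangular d) {i j : Fin d → ℤ} (h : toLex i < toLex j) :
    toLex (act f i) < toLex (act f j) := by
  obtain ⟨k, hk, hlt⟩ := toLex_lt_iff.1 h
  have key : ∀ m ≤ k, act f i m - i m = act f j m - j m := by
    intro m hm
    rw [act_eq_add, act_eq_add]
    rw [Finset.sum_congr rfl fun l hl => by
      rw [hk l ((Finset.mem_filter.1 hl).2.trans_le hm)]]
    ring
  refine toLex_lt_iff.2 ⟨k, fun l hl => ?_, ?_⟩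
  · have := key l hl.le
    rw [hk l hl] at this
    linarith
  · have := key k le_rfl
    linarith

theorem exists_act_zero_eq (i : Fin d → ℤ) : ∃ f : lowerUnitriangular d, act f 0 = i := by
  -- The identity with its first column replaced by (1, i).
  let A : Matrix (Fin (d + 1)) (Fin (d + 1)) ℤ :=
    fun k l => if k = l then 1 else if l = 0 then (Fin.cons 1 i : Fin (d + 1) → ℤ) k else 0
  have hdiag : ∀ k, A k k = 1 := fun k => by simp [A]
  have hupper : ∀ k l, k < l → A k l = 0 := fun k l h => by
    simp [A, h.ne, ((Fin.zero_le k).trans_lt h).ne']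
  have hdet : A.det = 1 := by
    rw [Matrix.det_of_isLowerTriangular A fun k l h => hupper k l h]
    simp [hdiag]
  refine ⟨⟨⟨A, hdet⟩, hdiag, hupper⟩, ?_⟩
  funext k
  rw [act_eq_add]
  simp [A]

/-- When coordinate l, counted from 0, has size at most r^(l+1), the displacement of coordinate k is
affine in the earlier ones and hence one order of r smaller than the bound r^(k+1) for coordinate k
itself. -/
theorem exists_abs_act_sub_le (f : lowerUnitriangular d) :
    ∃ C : ℕ, ∀ (i : Fin d → ℤ) (k : Fin d) (r : ℕ), 1 ≤ r →
      (∀ l < k, |i l| ≤ (r : ℤ) ^ ((l : ℕ) + 1)) →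
      |act f i k - i k| ≤ (C : ℤ) * (r : ℤ) ^ (k : ℕ) := by
  refine ⟨∑ k, ∑ l, (f.1.1 k l).natAbs, fun i k r hr hi => ?_⟩
  have hr' : (1 : ℤ) ≤ r := by exact_mod_cast hr
  have h1 : |act f i k - i k| ≤ ∑ l, |f.1.1 k.succ l| * (r : ℤ) ^ (k : ℕ) := by
    rw [act_eq_add, Fin.sum_univ_succ]
    have : i k + f.1.1 k.succ 0 + ∑ l ∈ Finset.univ.filter (· < k), f.1.1 k.succ l.succ * i l - i k
      = f.1.1 k.succ 0 + ∑ l ∈ Finset.univ.filter (· < k), f.1.1 k.succ l.succ * i l := by ring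
    rw [this]
    refine (abs_add_le _ _).trans (add_le_add ?_ ?_)
    · exact le_mul_of_one_le_right (abs_nonneg _) (one_le_pow₀ hr')
    · refine (Finset.abs_sum_le_sum_abs _ _).trans ?_
      refine (Finset.sum_le_sum fun l hl => ?_).trans
        (Finset.sum_le_sum_of_subset_of_nonneg (Finset.filter_subset _ _)
          fun l _ _ => by positivity)
      have hl' : l < k := (Finset.mem_filter.1 hl).2
      rw [abs_mul]
      gcongr
      exact (hi l hl').trans (pow_le_pow_right₀ hr' hl')
  refine h1.trans ?_
  rw [← Finset.sum_mul]
  gcongr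
  push_cast
  exact Finset.single_le_sum (f := fun k => ∑ l, |f.1.1 k l|)
    (fun k _ => Finset.sum_nonneg fun l _ => abs_nonneg _) (Finset.mem_univ k.succ)

end Action

/-! ### The action as a skew product over `ℤ^n` -/

section Skew

variable {n : ℕ}

theorem toLex_snoc_lt_snoc {v w : Fin n → ℤ} {j k : ℤ} :
    toLex (Fin.snoc v j : Fin (n + 1) → ℤ) < toLex (Fin.snoc w k : Fin (n + 1) → ℤ) ↔
      toLex v < toLex w ∨ v = w ∧ j < k := by
  rw [toLex_lt_iff, toLex_lt_iff]
  constructor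
  · rintro ⟨m, hm, hlt⟩
    induction m using Fin.lastCases with
    | last =>
      refine Or.inr ⟨funext fun l => ?_, by simpa using hlt⟩
      simpa using hm l.castSucc (Fin.castSucc_lt_last l)
    | cast m =>
      refine Or.inl ⟨m, fun l hl => ?_, by simpa using hlt⟩
      simpa using hm l.castSucc (Fin.castSucc_lt_castSucc_iff.2 hl)
  · rintro (⟨m, hm, hlt⟩ | ⟨rfl, hlt⟩)
    · refine ⟨m.castSucc, fun l hl => ?_, by simpa using hlt⟩
      induction l using Fin.lastCases with
      | last => exact absurd hl (not_lt.2 (Fin.le_last _))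
      | cast l => simpa using hm l (Fin.castSucc_lt_castSucc_iff.1 hl)
    · refine ⟨Fin.last n, fun l hl => ?_, by simpa using hlt⟩
      induction l using Fin.lastCases with
      | last => exact absurd hl (lt_irrefl _)
      | cast l => simp

/-- The action on the first `n` coordinates. -/
def baseAct (f : lowerUnitriangular (n + 1)) (v : Fin n → ℤ) : Fin n → ℤ :=
  Fin.init (act f (Fin.snoc v 0))

/-- The translation of the last coordinate over the base point `v`. -/
def shift (f : lowerUnitriangular (n + 1)) (v : Fin n → ℤ) : ℤ :=
  act f (Fin.snoc v 0) (Fin.last n)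

/-- By triangularity the last coordinate enters only its own row, with coefficient 1. -/
theorem act_snoc (f : lowerUnitriangular (n + 1)) (v : Fin n → ℤ) (j : ℤ) :
    act f (Fin.snoc v j) = Fin.snoc (baseAct f v) (shift f v + j) := by
  have key : ∀ k : Fin (n + 1),
      ∑ l ∈ Finset.univ.filter (· < k), f.1.1 k.succ l.succ * (Fin.snoc v j : Fin (n + 1) → ℤ) l =
      ∑ l ∈ Finset.univ.filter (· < k), f.1.1 k.succ l.succ *
        (Fin.snoc v 0 : Fin (n + 1) → ℤ) l := by
    intro k
    refine Finset.sum_congr rfl fun l hl => ?_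
    induction l using Fin.lastCases with
    | last => exact absurd (Finset.mem_filter.1 hl).2 (not_lt.2 (Fin.le_last _))
    | cast l => simp
  funext k
  rw [act_eq_add, key]
  induction k using Fin.lastCases with
  | last => simp only [Fin.snoc_last, shift, act_eq_add]; ring
  | cast k => simp only [Fin.snoc_castSucc, baseAct, Fin.init, act_eq_add]

theorem baseAct_mul (f g : lowerUnitriangular (n + 1)) (v : Fin n → ℤ) :
    baseAct (f * g) v = baseAct f (baseAct g v) := by
  have h := act_mul f g (Fin.snoc v 0)
  rw [act_snoc, act_snoc, act_snoc] at h
  simpa using congrArg Fin.init h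

theorem shift_mul (f g : lowerUnitriangular (n + 1)) (v : Fin n → ℤ) :
    shift (f * g) v = shift f (baseAct g v) + shift g v := by
  have h := act_mul f g (Fin.snoc v 0)
  rw [act_snoc, act_snoc, act_snoc] at h
  simpa using congrFun h (Fin.last n)

theorem baseAct_one (v : Fin n → ℤ) : baseAct (1 : lowerUnitriangular (n + 1)) v = v := by
  rw [baseAct, act_one, Fin.init_snoc]

theorem shift_one (v : Fin n → ℤ) : shift (1 : lowerUnitriangular (n + 1)) v = 0 := by
  rw [shift, act_one, Fin.snoc_last]

theorem baseAct_lt (f : lowerUnitriangular (n + 1)) {v w : Fin n → ℤ} (h : toLex v < toLex w) :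
    toLex (baseAct f v) < toLex (baseAct f w) := by
  have hne : baseAct f v ≠ baseAct f w := by
    intro he
    have h2 := congrArg (baseAct f⁻¹) he
    rw [← baseAct_mul, ← baseAct_mul, inv_mul_cancel, baseAct_one, baseAct_one] at h2
    rw [h2] at h
    exact lt_irrefl _ h
  have h1 := act_lt_act f (toLex_snoc_lt_snoc (j := 0) (k := 0) |>.2 (Or.inl h))
  rw [act_snoc, act_snoc, toLex_snoc_lt_snoc] at h1
  exact h1.resolve_right fun h => hne h.1

/-- The skew-product action on `ℤ^n × ℝ`, in which the block of index `(v, j)` is the unit interval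
`{v} × [j, j + 1]`. -/
def skew (f : lowerUnitriangular (n + 1)) (p : (Fin n → ℤ) × ℝ) : (Fin n → ℤ) × ℝ :=
  (baseAct f p.1, p.2 + shift f p.1)

theorem skew_mul (f g : lowerUnitriangular (n + 1)) (p : (Fin n → ℤ) × ℝ) :
    skew (f * g) p = skew f (skew g p) := by
  simp only [skew, baseAct_mul, shift_mul]
  push_cast
  congr 1
  ring

theorem skew_one (p : (Fin n → ℤ) × ℝ) : skew (1 : lowerUnitriangular (n + 1)) p = p := by
  simp [skew, baseAct_one, shift_one]

end Skew

/-! ### Endpoints of the blocks -/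

section LeftEnd

variable {d : ℕ} {ℓ : (Fin d → ℤ) → ℝ}

theorem leftEnd_eq_tsum (i : Fin d → ℤ) :
    leftEnd ℓ i = ∑' j, {j : Fin d → ℤ | toLex j < toLex i}.indicator ℓ j :=
  tsum_subtype {j : Fin d → ℤ | toLex j < toLex i} ℓ

theorem leftEnd_nonneg (hpos : ∀ i, 0 < ℓ i) (i : Fin d → ℤ) : 0 ≤ leftEnd ℓ i :=
  tsum_nonneg fun j => (hpos j).le

theorem leftEnd_add_eq_tsum (hs : Summable ℓ) (i : Fin d → ℤ) :
    leftEnd ℓ i + ℓ i = ∑' j, {j : Fin d → ℤ | toLex j ≤ toLex i}.indicator ℓ j := by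
  have h1 : HasSum ({j : Fin d → ℤ | toLex j < toLex i}.indicator ℓ) (leftEnd ℓ i) := by
    rw [leftEnd_eq_tsum]
    exact (hs.indicator _).hasSum
  have h2 : HasSum (({i} : Set (Fin d → ℤ)).indicator ℓ) (ℓ i) := by
    have := hasSum_single (f := ({i} : Set (Fin d → ℤ)).indicator ℓ) i
      fun j hj => indicator_of_notMem (by simpa using hj) _
    simpa using this
  rw [← (h1.add h2).tsum_eq]
  refine tsum_congr fun j => ?_
  rcases lt_trichotomy (toLex j) (toLex i) with h | h | h
  · have hne : j ∉ ({i} : Set (Fin d → ℤ)) := by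
      rintro rfl
      exact lt_irrefl _ h
    rw [indicator_of_mem (show j ∈ {j | toLex j < toLex i} from h), indicator_of_notMem hne,
      indicator_of_mem (show j ∈ {j | toLex j ≤ toLex i} from h.le), add_zero]
  · obtain rfl := toLex_inj.1 h
    rw [indicator_of_notMem (show j ∉ {k | toLex k < toLex j} from
        fun h : toLex j < toLex j => lt_irrefl _ h),
      indicator_of_mem (mem_singleton j),
      indicator_of_mem (show j ∈ {k | toLex k ≤ toLex j} from le_refl (toLex j)), zero_add]
  · have hne : j ∉ ({i} : Set (Fin d → ℤ)) := by
      rintro rfl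
      exact lt_irrefl _ h
    rw [indicator_of_notMem (show j ∉ {j | toLex j < toLex i} from h.not_gt),
      indicator_of_notMem hne,
      indicator_of_notMem (show j ∉ {j | toLex j ≤ toLex i} from h.not_ge), add_zero]

theorem leftEnd_add_le (hpos : ∀ i, 0 < ℓ i) (hs : Summable ℓ) {i j : Fin d → ℤ}
    (h : toLex i < toLex j) : leftEnd ℓ i + ℓ i ≤ leftEnd ℓ j := by
  rw [leftEnd_add_eq_tsum hs, leftEnd_eq_tsum]
  refine (hs.indicator _).tsum_le_tsum (fun k => ?_) (hs.indicator _)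
  exact indicator_le_indicator_of_subset (fun k hk => lt_of_le_of_lt hk h)
    (fun k => (hpos k).le) k

theorem leftEnd_add_le_one (hpos : ∀ i, 0 < ℓ i) (hs : HasSum ℓ 1) (i : Fin d → ℤ) :
    leftEnd ℓ i + ℓ i ≤ 1 := by
  rw [leftEnd_add_eq_tsum hs.summable, ← hs.tsum_eq]
  exact (hs.summable.indicator _).tsum_le_tsum
    (fun k => indicator_le_self' (fun _ _ => (hpos k).le) k) hs.summable

/-- The indices (v, j) and (v, j + 1) are consecutive in the lexicographic order. -/
theorem leftEnd_snoc_add_one {n : ℕ} {ℓ : (Fin (n + 1) → ℤ) → ℝ} (hs : Summable ℓ)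
    (v : Fin n → ℤ) (j : ℤ) :
    leftEnd ℓ (Fin.snoc v (j + 1)) = leftEnd ℓ (Fin.snoc v j) + ℓ (Fin.snoc v j) := by
  rw [leftEnd_add_eq_tsum hs, leftEnd_eq_tsum]
  congr 1
  funext i
  congr 1
  ext i
  rw [mem_ofPred_eq, mem_ofPred_eq, le_iff_lt_or_eq]
  obtain ⟨w, k, rfl⟩ : ∃ (w : Fin n → ℤ) (k : ℤ), i = Fin.snoc w k :=
    ⟨Fin.init i, i (Fin.last n), (Fin.snoc_init_self i).symm⟩
  have h : toLex (Fin.snoc w k : Fin (n + 1) → ℤ) = toLex (Fin.snoc v j : Fin (n + 1) → ℤ) ↔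
      w = v ∧ k = j := by rw [toLex_inj, Fin.snoc_inj]
  rw [toLex_snoc_lt_snoc, Int.lt_add_one_iff, le_iff_lt_or_eq, h]
  refine Iff.trans ?_ (or_congr_left toLex_snoc_lt_snoc.symm)
  tauto

/-- The blocks already have total measure 1, so an open interval missing all of them would not fit
in [0,1]. -/
theorem exists_mem_block_between (hpos : ∀ i, 0 < ℓ i) (hs : HasSum ℓ 1) {x y : unitInterval}
    (hxy : x < y) : ∃ i, ∃ z : unitInterval, z ∈ Ioo x y ∧
      leftEnd ℓ i ≤ (z : ℝ) ∧ (z : ℝ) < leftEnd ℓ i + ℓ i := by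
  by_contra! hcon
  let B : (Fin d → ℤ) → Set ℝ := fun i => Ico (leftEnd ℓ i) (leftEnd ℓ i + ℓ i)
  have hdisj : Pairwise (Function.onFun Disjoint B) := by
    intro i j hij
    have key : ∀ {i j : Fin d → ℤ}, toLex i < toLex j → Disjoint (B i) (B j) := fun h =>
      Set.disjoint_left.2 fun z hz hz' =>
        (hz.2.trans_le (leftEnd_add_le hpos hs.summable h)).not_ge hz'.1
    rcases lt_or_gt_of_ne (fun e => hij (toLex_inj.1 e) : toLex i ≠ toLex j) with h | h
    · exact key h
    · exact (key h).symm
  have hvol : volume (⋃ i, B i) = 1 := by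
    rw [measure_iUnion hdisj fun i => measurableSet_Ico]
    simp only [B, Real.volume_Ico, add_sub_cancel_left]
    rw [← ENNReal.ofReal_tsum_of_nonneg (fun i => (hpos i).le) hs.summable, hs.tsum_eq,
      ENNReal.ofReal_one]
  have hsub : (⋃ i, B i) ∪ Ioo (x : ℝ) y ⊆ Icc 0 1 := by
    refine union_subset (iUnion_subset fun i z hz => ?_) fun z hz => ?_
    · exact ⟨(leftEnd_nonneg hpos i).trans hz.1, hz.2.le.trans (leftEnd_add_le_one hpos hs i)⟩
    · exact ⟨x.2.1.trans hz.1.le, hz.2.le.trans y.2.2⟩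
  have hd : Disjoint (⋃ i, B i) (Ioo (x : ℝ) y) := by
    refine Set.disjoint_left.2 fun z hz hz' => ?_
    obtain ⟨i, hi⟩ := mem_iUnion.1 hz
    exact (hcon i ⟨z, hsub (Or.inl hz)⟩ ⟨hz'.1, hz'.2⟩ hi.1).not_gt hi.2
  have h := measure_mono (μ := volume) hsub
  rw [measure_union hd measurableSet_Ioo, hvol, Real.volume_Ioo, Real.volume_Icc] at h
  have hpos' : 0 < ENNReal.ofReal ((y : ℝ) - x) := ENNReal.ofReal_pos.2 (sub_pos.2 hxy)
  simp only [sub_zero, ENNReal.ofReal_one] at h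
  exact absurd h (not_le.2 (ENNReal.lt_add_right ENNReal.one_ne_top hpos'.ne'))

end LeftEnd

/-! ### Lexicographic embeddings and extension of the skew product -/

section LexEmbedding

variable {n : ℕ}

/-- A strictly increasing map with dense range from `ℤ^n × ℝ`, ordered lexicographically,
to `[0,1]`. -/
structure IsLexEmbedding (P : (Fin n → ℤ) × ℝ → unitInterval) : Prop where
  lt_of_base_lt : ∀ {v w : Fin n → ℤ} (s t : ℝ), toLex v < toLex w → P (v, s) < P (w, t)
  strictMono : ∀ v, StrictMono fun t => P (v, t)
  denseRange : DenseRange P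

namespace IsLexEmbedding

variable {P : (Fin n → ℤ) × ℝ → unitInterval}

theorem lt_iff (hP : IsLexEmbedding P) {p q : (Fin n → ℤ) × ℝ} :
    P p < P q ↔ toLex p.1 < toLex q.1 ∨ p.1 = q.1 ∧ p.2 < q.2 := by
  obtain ⟨v, s⟩ := p
  obtain ⟨w, t⟩ := q
  rcases lt_trichotomy (toLex v) (toLex w) with h | h | h
  · exact iff_of_true (hP.lt_of_base_lt s t h) (Or.inl h)
  · obtain rfl := toLex_inj.1 h
    exact ((hP.strictMono v).lt_iff_lt (a := s) (b := t)).trans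
      ⟨fun h' => Or.inr ⟨rfl, h'⟩, fun h' => (h'.resolve_left (lt_irrefl _)).2⟩
  · refine iff_of_false (hP.lt_of_base_lt t s h).not_gt ?_
    rintro (h' | ⟨h', -⟩)
    · exact h.not_gt h'
    · exact absurd h (by rw [show v = w from h']; exact lt_irrefl _)

theorem injective (hP : IsLexEmbedding P) : Function.Injective P := by
  rintro ⟨v, s⟩ ⟨w, t⟩ h
  rcases lt_trichotomy (toLex v) (toLex w) with h' | h' | h'
  · exact absurd h (hP.lt_of_base_lt s t h').ne
  · obtain rfl := toLex_inj.1 h'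
    rw [(hP.strictMono v).injective h]
  · exact absurd h (hP.lt_of_base_lt t s h').ne'

theorem skew_lt_skew (hP : IsLexEmbedding P) (f : lowerUnitriangular (n + 1))
    {p q : (Fin n → ℤ) × ℝ} (h : P p < P q) : P (skew f p) < P (skew f q) := by
  rw [hP.lt_iff] at h ⊢
  rcases h with h | ⟨h1, h2⟩
  · exact Or.inl (baseAct_lt f h)
  · exact Or.inr ⟨by simp [skew, h1], by simpa [skew, h1] using h2⟩

theorem skew_le_skew (hP : IsLexEmbedding P) (f : lowerUnitriangular (n + 1))
    {p q : (Fin n → ℤ) × ℝ} (h : P p ≤ P q) : P (skew f p) ≤ P (skew f q) := by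
  rcases h.lt_or_eq with h | h
  · exact (hP.skew_lt_skew f h).le
  · rw [hP.injective h]

theorem measurable (hP : IsLexEmbedding P) : Measurable P :=
  measurable_from_prod_countable_right fun v => (hP.strictMono v).monotone.measurable

/-- A family of parametrizations of the half-open blocks gives a lexicographic embedding. -/
theorem of_blocks {ℓ : (Fin (n + 1) → ℤ) → ℝ} (hpos : ∀ i, 0 < ℓ i) (hs : HasSum ℓ 1)
    (p : (Fin (n + 1) → ℤ) → ℝ → unitInterval) (hp : ∀ i, StrictMonoOn (p i) (Ico 0 1))
    (himg : ∀ i, p i '' Ico 0 1 =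
      {x : unitInterval | leftEnd ℓ i ≤ (x : ℝ) ∧ (x : ℝ) < leftEnd ℓ i + ℓ i}) :
    IsLexEmbedding fun q : (Fin n → ℤ) × ℝ => p (Fin.snoc q.1 ⌊q.2⌋) (Int.fract q.2) := by
  have hfr : ∀ t : ℝ, Int.fract t ∈ Ico (0 : ℝ) 1 := fun t =>
    ⟨Int.fract_nonneg t, Int.fract_lt_one t⟩
  have hmem : ∀ i (t : ℝ), leftEnd ℓ i ≤ (p i (Int.fract t) : ℝ) ∧
      (p i (Int.fract t) : ℝ) < leftEnd ℓ i + ℓ i := fun i t => by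
    have := mem_image_of_mem (p i) (hfr t)
    rwa [himg] at this
  have hlt : ∀ {i j : Fin (n + 1) → ℤ} (s t : ℝ), toLex i < toLex j →
      p i (Int.fract s) < p j (Int.fract t) := fun {i j} s t h =>
    Subtype.coe_lt_coe.1 <| (hmem i s).2.trans_le <|
      (leftEnd_add_le hpos hs.summable h).trans (hmem j t).1
  refine ⟨fun s t h => hlt s t (toLex_snoc_lt_snoc.2 (Or.inl h)), fun v s t hst => ?_, ?_⟩
  · rcases (Int.floor_mono hst.le).lt_or_eq with h | h
    · exact hlt s t (toLex_snoc_lt_snoc.2 (Or.inr ⟨rfl, h⟩))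
    · simp only [h]
      refine hp _ (hfr s) (hfr t) ?_
      rw [Int.fract, Int.fract, h]
      linarith
  · refine dense_of_exists_between fun {x y} hxy => ?_
    obtain ⟨i, z, hz, hzi⟩ := exists_mem_block_between hpos hs hxy
    obtain ⟨s, hs, rfl⟩ : z ∈ p i '' Ico 0 1 := by rw [himg]; exact hzi
    refine ⟨_, ⟨(Fin.init i, (i (Fin.last n) : ℝ) + s), ?_⟩, hz⟩
    have hfl : ⌊s⌋ = 0 := Int.floor_eq_zero_iff.2 hs
    have hfs : Int.fract s = s := Int.fract_eq_self.2 hs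
    simp [hfl, hfs]

/-- The extension to `[0,1]` of the action on `ℤ^n × ℝ`. -/
noncomputable def extend (P : (Fin n → ℤ) × ℝ → unitInterval) (f : lowerUnitriangular (n + 1))
    (x : unitInterval) : unitInterval :=
  sSup ((fun p => P (skew f p)) '' {p | P p ≤ x})

theorem extend_apply (hP : IsLexEmbedding P) (f : lowerUnitriangular (n + 1))
    (p : (Fin n → ℤ) × ℝ) : extend P f (P p) = P (skew f p) := by
  refine IsGreatest.csSup_eq ⟨⟨p, le_refl (P p), rfl⟩, ?_⟩
  rintro _ ⟨q, hq, rfl⟩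
  exact hP.skew_le_skew f hq

/-- A monotone map with dense range into [0,1] has no jumps. -/
theorem extend_continuous (hP : IsLexEmbedding P) (f : lowerUnitriangular (n + 1)) :
    Continuous (extend P f) := by
  refine Monotone.continuous_of_denseRange (fun x y hxy => ?_) ?_
  · exact sSup_le_sSup (image_mono fun p hp => le_trans hp hxy)
  · refine hP.denseRange.mono ?_
    rintro _ ⟨p, rfl⟩
    exact ⟨P (skew f⁻¹ p), by
      rw [hP.extend_apply, ← skew_mul, mul_inv_cancel, skew_one]⟩

theorem extend_mul (hP : IsLexEmbedding P) (f g : lowerUnitriangular (n + 1)) :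
    extend P (f * g) = extend P f ∘ extend P g := by
  refine hP.denseRange.equalizer (hP.extend_continuous _)
    ((hP.extend_continuous f).comp (hP.extend_continuous g)) ?_
  funext p
  simp only [Function.comp, hP.extend_apply, skew_mul]

theorem extend_one (hP : IsLexEmbedding P) :
    extend P (1 : lowerUnitriangular (n + 1)) = id := by
  refine hP.denseRange.equalizer (hP.extend_continuous _) continuous_id ?_
  funext p
  simp only [Function.comp, hP.extend_apply, skew_one, id]

theorem extend_strictMono (hP : IsLexEmbedding P) (f : lowerUnitriangular (n + 1)) :
    StrictMono (extend P f) := by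
  refine Monotone.strictMono_of_injective (fun x y hxy => ?_)
    (Function.LeftInverse.injective (g := extend P f⁻¹) fun x => ?_)
  · exact sSup_le_sSup (image_mono fun p hp => le_trans hp hxy)
  · have := congrFun (hP.extend_mul f⁻¹ f) x
    rw [inv_mul_cancel, hP.extend_one] at this
    exact this.symm

/-- The extension to `[0,1]` of the action on `ℤ^n × ℝ`, as a group action. -/
noncomputable def extendHom (hP : IsLexEmbedding P) :
    lowerUnitriangular (n + 1) →* (unitInterval ≃ₜ unitInterval) where
  toFun f :=
    { toFun := extend P f
      invFun := extend P f⁻¹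
      left_inv := fun x => by
        have := congrFun (hP.extend_mul f⁻¹ f) x
        rw [inv_mul_cancel, hP.extend_one] at this
        exact this.symm
      right_inv := fun x => by
        have := congrFun (hP.extend_mul f f⁻¹) x
        rw [mul_inv_cancel, hP.extend_one] at this
        exact this.symm
      continuous_toFun := hP.extend_continuous f
      continuous_invFun := hP.extend_continuous f⁻¹ }
  map_one' := Homeomorph.ext fun x => congrFun hP.extend_one x
  map_mul' f g := Homeomorph.ext fun x => congrFun (hP.extend_mul f g) x

theorem extendHom_apply (hP : IsLexEmbedding P) (f : lowerUnitriangular (n + 1))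
    (p : (Fin n → ℤ) × ℝ) : hP.extendHom f (P p) = P (skew f p) := hP.extend_apply f p

end IsLexEmbedding

/-- Any positive lengths of sum 1 serve: parametrize the blocks affinely and extend the skew
product. -/
theorem exists_isFarbFranksAction (n : ℕ) :
    ∃ φ : lowerUnitriangular (n + 1) →* (unitInterval ≃ₜ unitInterval),
      IsFarbFranksAction (n + 1) φ := by
  have : Encodable (Fin (n + 1) → ℤ) := Encodable.ofCountable _
  obtain ⟨e, hepos, c, hec, -⟩ := posSumOfEncodable one_pos (Fin (n + 1) → ℤ)
  have hc : 0 < c := hec.tsum_eq ▸ hec.summable.tsum_pos (fun i => (hepos i).le) 0 (hepos 0)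
  let ℓ : (Fin (n + 1) → ℤ) → ℝ := fun i => e i / c
  have hpos : ∀ i, 0 < ℓ i := fun i => div_pos (hepos i) hc
  have hs : HasSum ℓ 1 := by simpa [hc.ne'] using hec.div_const c
  let p : (Fin (n + 1) → ℤ) → ℝ → unitInterval := fun i s =>
    projIcc 0 1 zero_le_one (leftEnd ℓ i + s * ℓ i)
  have hpval : ∀ i, ∀ s ∈ Icc (0 : ℝ) 1, (p i s : ℝ) = leftEnd ℓ i + s * ℓ i := by
    intro i s hs'
    have h1 : leftEnd ℓ i + s * ℓ i ∈ Icc (0 : ℝ) 1 := by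
      have := leftEnd_nonneg hpos i
      have h2 := leftEnd_add_le_one hpos hs i
      have h3 := hpos i
      constructor
      · nlinarith [hs'.1]
      · nlinarith [hs'.2]
    simp only [p, projIcc_of_mem _ h1]
  have hp : ∀ i, StrictMonoOn (p i) (Ico 0 1) := by
    intro i s hs' t ht' hst
    rw [← Subtype.coe_lt_coe, hpval i s (Ico_subset_Icc_self hs'),
      hpval i t (Ico_subset_Icc_self ht')]
    nlinarith [hpos i]
  have himg : ∀ i, p i '' Ico 0 1 =
      {x : unitInterval | leftEnd ℓ i ≤ (x : ℝ) ∧ (x : ℝ) < leftEnd ℓ i + ℓ i} := by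
    intro i
    have h3 := hpos i
    ext x
    constructor
    · rintro ⟨s, hs', rfl⟩
      rw [mem_ofPred_eq, hpval i s (Ico_subset_Icc_self hs')]
      exact ⟨by nlinarith [hs'.1], by nlinarith [hs'.2]⟩
    · rintro ⟨h1, h2⟩
      have hmem : ((x : ℝ) - leftEnd ℓ i) / ℓ i ∈ Ico (0 : ℝ) 1 :=
        ⟨div_nonneg (by linarith) h3.le, (div_lt_one h3).2 (by linarith)⟩
      refine ⟨_, hmem, Subtype.ext ?_⟩
      rw [hpval i _ (Ico_subset_Icc_self hmem), div_mul_cancel₀ _ h3.ne']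
      ring
  have hP := IsLexEmbedding.of_blocks hpos hs p hp himg
  set P := fun q : (Fin n → ℤ) × ℝ => p (Fin.snoc q.1 ⌊q.2⌋) (Int.fract q.2) with hPdef
  have hblock : ∀ v (j : ℤ), block ℓ (Fin.snoc v j) = (fun t => P (v, t)) '' Icc j (j + 1) := by
    intro v j
    -- The parametrization covers half-open blocks; the right endpoint is the left endpoint of the
    -- next block on the same line.
    have hend : ((P (v, (j : ℝ) + 1)) : ℝ) = leftEnd ℓ (Fin.snoc v j) + ℓ (Fin.snoc v j) := by
      have h := hpval (Fin.snoc v (j + 1)) 0 (by simp)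
      rw [leftEnd_snoc_add_one hs.summable] at h
      simpa [hPdef] using h
    have hIco : (fun t => P (v, t)) '' Ico (j : ℝ) (j + 1) =
        {x : unitInterval | leftEnd ℓ (Fin.snoc v j) ≤ (x : ℝ) ∧
          (x : ℝ) < leftEnd ℓ (Fin.snoc v j) + ℓ (Fin.snoc v j)} := by
      rw [← himg]
      ext x
      constructor
      · rintro ⟨t, ht, rfl⟩
        have hfl : ⌊t⌋ = j := Int.floor_eq_iff.2 ht
        exact ⟨Int.fract t, ⟨Int.fract_nonneg t, Int.fract_lt_one t⟩, by simp [hPdef, hfl]⟩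
      · rintro ⟨s, hs', rfl⟩
        refine ⟨j + s, ⟨by linarith [hs'.1], by linarith [hs'.2]⟩, ?_⟩
        have hfl : ⌊s⌋ = 0 := Int.floor_eq_zero_iff.2 hs'
        have hfs : Int.fract s = s := Int.fract_eq_self.2 hs'
        simp [hPdef, hfl, hfs]
    rw [← Ico_insert_right (by linarith : (j : ℝ) ≤ j + 1), image_insert_eq, hIco]
    ext x
    simp only [block, mem_ofPred_eq, mem_insert_iff, Subtype.ext_iff, hend]
    have := hpos (Fin.snoc v j)
    constructor
    · rintro ⟨h1, h2⟩
      rcases h2.lt_or_eq with h | h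
      · exact Or.inr ⟨h1, h⟩
      · exact Or.inl h
    · rintro (h | ⟨h1, h2⟩)
      · exact ⟨by linarith, h.le⟩
      · exact ⟨h1, h2.le⟩
  have hsn : ∀ i : Fin (n + 1) → ℤ, ∃ v j, i = Fin.snoc v j := fun i =>
    ⟨Fin.init i, i (Fin.last n), (Fin.snoc_init_self i).symm⟩
  refine ⟨hP.extendHom, hP.extend_strictMono, ℓ, hpos, hs, fun f i => ?_, fun f g i hfg => ?_⟩
  · obtain ⟨v, j, rfl⟩ := hsn i
    rw [act_snoc, hblock, hblock, image_image]
    simp only [hP.extendHom_apply, skew]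
    have : (Icc ((shift f v + j : ℤ) : ℝ) ((shift f v + j : ℤ) + 1)) =
        (fun t : ℝ => t + shift f v) '' Icc (j : ℝ) (j + 1) := by
      rw [image_add_const_Icc]
      push_cast
      congr 1 <;> ring
    rw [this, image_image]
  · obtain ⟨v, j, rfl⟩ := hsn i
    rw [act_snoc, act_snoc, Fin.snoc_inj] at hfg
    rw [hblock]
    rintro _ ⟨t, -, rfl⟩
    have h2 : shift f v = shift g v := by linarith [hfg.2]
    simp only [hP.extendHom_apply, skew, hfg.1, h2]

/-- A chosen element taking index 0 to i transports the affine parametrization of the block of 0 to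
block i. Equivariance makes the result independent of that choice, so φ acts as the skew product in
these coordinates. -/
theorem IsFarbFranksAction.exists_isLexEmbedding
    {φ : lowerUnitriangular (n + 1) →* (unitInterval ≃ₜ unitInterval)}
    (hφ : IsFarbFranksAction (n + 1) φ) :
    ∃ P : (Fin n → ℤ) × ℝ → unitInterval, IsLexEmbedding P ∧
      ∀ f p, P (skew f p) = φ f (P p) := by
  obtain ⟨hmono, ℓ, hpos, hs, himgφ, heq⟩ := hφ
  choose g hg using exists_act_zero_eq (d := n + 1)
  let p₀ : ℝ → unitInterval := fun s => projIcc 0 1 zero_le_one (leftEnd ℓ 0 + s * ℓ 0)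
  have hpval : ∀ s ∈ Icc (0 : ℝ) 1, (p₀ s : ℝ) = leftEnd ℓ 0 + s * ℓ 0 := by
    intro s hs'
    have h1 : leftEnd ℓ 0 + s * ℓ 0 ∈ Icc (0 : ℝ) 1 := by
      have := leftEnd_nonneg hpos 0
      have h2 := leftEnd_add_le_one hpos hs 0
      have h3 := hpos 0
      constructor
      · nlinarith [hs'.1]
      · nlinarith [hs'.2]
    simp only [p₀, projIcc_of_mem _ h1]
  have hp₀ : StrictMonoOn p₀ (Icc 0 1) := by
    intro s hs' t ht' hst
    rw [← Subtype.coe_lt_coe, hpval s hs', hpval t ht']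
    nlinarith [hpos 0]
  have hp₀img : p₀ '' Icc 0 1 = block ℓ 0 := by
    have h3 := hpos 0
    ext x
    constructor
    · rintro ⟨s, hs', rfl⟩
      rw [block, mem_ofPred_eq, hpval s hs']
      exact ⟨by nlinarith [hs'.1], by nlinarith [hs'.2]⟩
    · rintro ⟨h1, h2⟩
      have hmem : ((x : ℝ) - leftEnd ℓ 0) / ℓ 0 ∈ Icc (0 : ℝ) 1 :=
        ⟨div_nonneg (by linarith) h3.le, (div_le_one h3).2 (by linarith)⟩
      refine ⟨_, hmem, Subtype.ext ?_⟩
      rw [hpval _ hmem, div_mul_cancel₀ _ h3.ne']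
      ring
  let p : (Fin (n + 1) → ℤ) → ℝ → unitInterval := fun i s => φ (g i) (p₀ s)
  have hpmono : ∀ i, StrictMonoOn (p i) (Icc 0 1) := fun i =>
    (hmono (g i)).comp_strictMonoOn hp₀
  have hpIcc : ∀ i, p i '' Icc 0 1 = block ℓ i := by
    intro i
    have : p i '' Icc 0 1 = φ (g i) '' (p₀ '' Icc 0 1) := (image_image _ _ _).symm
    rw [this, hp₀img, himgφ, hg]
  have hend : ∀ i, (p i 1 : ℝ) = leftEnd ℓ i + ℓ i := by
    intro i
    have h1 : p i 1 ∈ block ℓ i := hpIcc i ▸ mem_image_of_mem _ (by simp)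
    refine le_antisymm h1.2 ?_
    have h2 : leftEnd ℓ i + ℓ i ∈ Icc (0 : ℝ) 1 :=
      ⟨add_nonneg (leftEnd_nonneg hpos i) (hpos i).le, leftEnd_add_le_one hpos hs i⟩
    have h3 : (⟨_, h2⟩ : unitInterval) ∈ p i '' Icc 0 1 := by
      rw [hpIcc]
      exact ⟨by simp [(hpos i).le], le_rfl⟩
    obtain ⟨s, hs', hse⟩ := h3
    have h4 : p i s ≤ p i 1 := (hpmono i).monotoneOn hs' (by simp) hs'.2
    rw [hse] at h4
    exact h4
  have himg : ∀ i, p i '' Ico 0 1 =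
      {x : unitInterval | leftEnd ℓ i ≤ (x : ℝ) ∧ (x : ℝ) < leftEnd ℓ i + ℓ i} := by
    intro i
    ext x
    constructor
    · rintro ⟨s, hs', rfl⟩
      have h1 : p i s ∈ block ℓ i :=
        hpIcc i ▸ mem_image_of_mem _ (Ico_subset_Icc_self hs')
      refine ⟨h1.1, ?_⟩
      rw [← hend]
      exact hpmono i (Ico_subset_Icc_self hs') (by simp) hs'.2
    · rintro ⟨h1, h2⟩
      obtain ⟨s, hs', rfl⟩ : x ∈ p i '' Icc 0 1 := by rw [hpIcc]; exact ⟨h1, h2.le⟩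
      refine ⟨s, ⟨hs'.1, lt_of_le_of_ne hs'.2 ?_⟩, rfl⟩
      rintro rfl
      exact h2.ne (hend i)
  refine ⟨_, IsLexEmbedding.of_blocks hpos hs p (fun i => (hpmono i).mono Ico_subset_Icc_self)
    himg, ?_⟩
  rintro f ⟨v, t⟩
  have hmem : p₀ (Int.fract t) ∈ block ℓ 0 := by
    rw [← hp₀img]
    exact mem_image_of_mem _ ⟨Int.fract_nonneg t, (Int.fract_lt_one t).le⟩
  simp only [skew, Int.fract_add_intCast, Int.floor_add_intCast, p]
  have hidx : (Fin.snoc (baseAct f v) (⌊t⌋ + shift f v) : Fin (n + 1) → ℤ) =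
      act f (Fin.snoc v ⌊t⌋) := by rw [act_snoc, add_comm ⌊t⌋]
  have hact : act (g (Fin.snoc (baseAct f v) (⌊t⌋ + shift f v))) 0 =
      act (f * g (Fin.snoc v ⌊t⌋)) 0 := by
    rw [hg, act_mul, hg, hidx]
  -- Both elements send index 0 to the same index, so they agree on the block of 0.
  rw [heq _ _ 0 hact hmem, map_mul]
  rfl

end LexEmbedding

/-! ### Change of coordinate by a density -/

section Conjugation

variable {Ω : Type*} [MeasurableSpace Ω] {μ : Measure Ω} {P : Ω → unitInterval} {q : Ω → ℝ}

theorem setIntegral_mem_Icc (hq : Integrable q μ) (hq0 : ∀ p, 0 ≤ q p) (hq1 : ∫ p, q p ∂μ = 1)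
    (s : Set Ω) : ∫ p in s, q p ∂μ ∈ Icc (0 : ℝ) 1 :=
  ⟨integral_nonneg hq0, hq1 ▸ setIntegral_le_integral hq (ae_of_all _ hq0)⟩

theorem setIntegral_Ioc_preimage (hP : Measurable P) (hq : Integrable q μ) {x y : unitInterval}
    (hxy : x ≤ y) :
    ∫ p in P ⁻¹' Iic y, q p ∂μ - ∫ p in P ⁻¹' Iic x, q p ∂μ = ∫ p in P ⁻¹' Ioc x y, q p ∂μ := by
  have h : P ⁻¹' Iic y = P ⁻¹' Iic x ∪ P ⁻¹' Ioc x y := by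
    rw [← preimage_union, Iic_union_Ioc_eq_Iic hxy]
  rw [h, setIntegral_union _ (hP measurableSet_Ioc) hq.integrableOn hq.integrableOn]
  · ring
  · exact Disjoint.preimage P (Iic_disjoint_Ioc le_rfl)

/-- Dominated convergence: the indicators converge except where P equals the limit point, a null
set. -/
theorem continuous_setIntegral_Iic_preimage (hP : Measurable P) (hq : Integrable q μ)
    (hnull : ∀ x, μ (P ⁻¹' {x}) = 0) :
    Continuous fun x => ∫ p in P ⁻¹' Iic x, q p ∂μ := by
  simp_rw [← integral_indicator (hP measurableSet_Iic)]
  refine continuous_iff_continuousAt.2 fun x₀ => ?_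
  refine continuousAt_of_dominated (bound := fun p => ‖q p‖) ?_ ?_ hq.norm ?_
  · exact Eventually.of_forall fun x => hq.aestronglyMeasurable.indicator (hP measurableSet_Iic)
  · exact Eventually.of_forall fun x => Eventually.of_forall fun p => norm_indicator_le_norm_self _ _
  · have hae : ∀ᵐ p ∂μ, P p ≠ x₀ := by
      rw [ae_iff]
      convert hnull x₀ using 2
      ext p
      simp
    filter_upwards [hae] with p hp
    have hev : (fun x => (P ⁻¹' Iic x).indicator q p) =ᶠ[𝓝 x₀]
        fun _ => (P ⁻¹' Iic x₀).indicator q p := by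
      rcases lt_or_gt_of_ne hp with h | h
      · filter_upwards [lt_mem_nhds h] with x hx
        rw [indicator_of_mem (show p ∈ P ⁻¹' Iic x from hx.le),
          indicator_of_mem (show p ∈ P ⁻¹' Iic x₀ from h.le)]
      · filter_upwards [gt_mem_nhds h] with x hx
        rw [indicator_of_notMem (show p ∉ P ⁻¹' Iic x from hx.not_ge),
          indicator_of_notMem (show p ∉ P ⁻¹' Iic x₀ from h.not_ge)]
    exact ContinuousAt.congr continuousAt_const hev.symm

/-- The distribution function of a nonatomic probability density of full support is a
homeomorphism of `[0,1]`. -/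
theorem exists_homeomorph_setIntegral (hP : Measurable P) (hq : Integrable q μ)
    (hq0 : ∀ p, 0 ≤ q p) (hq1 : ∫ p, q p ∂μ = 1) (hnull : ∀ x, μ (P ⁻¹' {x}) = 0)
    (hpos : ∀ x y, x < y → 0 < ∫ p in P ⁻¹' Ioc x y, q p ∂μ) :
    ∃ H : unitInterval ≃ₜ unitInterval, StrictMono H ∧
      ∀ x, (H x : ℝ) = ∫ p in P ⁻¹' Iic x, q p ∂μ := by
  let F : unitInterval → unitInterval := fun x =>
    ⟨∫ p in P ⁻¹' Iic x, q p ∂μ, setIntegral_mem_Icc hq hq0 hq1 _⟩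
  have hmono : StrictMono F := by
    intro x y hxy
    have h := setIntegral_Ioc_preimage hP hq hxy.le
    have h' := hpos x y hxy
    refine Subtype.coe_lt_coe.1 ?_
    change ∫ p in P ⁻¹' Iic x, q p ∂μ < ∫ p in P ⁻¹' Iic y, q p ∂μ
    linarith
  have hcont : Continuous F :=
    (continuous_setIntegral_Iic_preimage hP hq hnull).subtype_mk _
  have h0 : F 0 = 0 := by
    refine Subtype.ext ?_
    have : P ⁻¹' Iic (0 : unitInterval) = P ⁻¹' {0} := by
      congr 1
      exact Iic_bot
    simp only [F, this]
    simpa using setIntegral_measure_zero q (hnull 0)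
  have h1 : F 1 = 1 := by
    refine Subtype.ext ?_
    have : P ⁻¹' Iic (1 : unitInterval) = univ := by
      rw [show Iic (1 : unitInterval) = univ from Iic_top, preimage_univ]
    simp only [F, this, setIntegral_univ, hq1]
    rfl
  have hsurj : Function.Surjective F := by
    intro y
    have := intermediate_value_Icc (zero_le_one (α := unitInterval)) hcont.continuousOn
    rw [h0, h1] at this
    obtain ⟨x, -, hx⟩ := this ⟨y.2.1, y.2.2⟩
    exact ⟨x, hx⟩
  refine ⟨(hmono.orderIsoOfSurjective F hsurj).toHomeomorph, ?_, fun x => rfl⟩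
  exact (hmono.orderIsoOfSurjective F hsurj).strictMono

/-- Regularity of a conjugate map, given the density of the image measure. -/
theorem isC1HolderDiffeo_conj {α : ℝ} (hα : 0 < α) (hP : Measurable P) (hq : Integrable q μ)
    (hq0 : ∀ p, 0 ≤ q p) {H : unitInterval ≃ₜ unitInterval} (hHmono : StrictMono H)
    (hH : ∀ x, (H x : ℝ) = ∫ p in P ⁻¹' Iic x, q p ∂μ)
    {φ ψ : unitInterval ≃ₜ unitInterval} (hφ : StrictMono φ)
    (hψ : ∀ x, H (φ x) = ψ (H x))
    {A : Ω → Ω} (hA : MeasurePreserving A μ μ) (hAe : MeasurableEmbedding A)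
    (hAP : ∀ p, P (A p) = φ (P p))
    {G : unitInterval → ℝ} (hG : ∀ p, q (A p) = G (H (P p)) * q p) (hGpos : ∀ y, 0 < G y)
    {M : ℝ} (hM : ∀ x y : unitInterval, |G x - G y| ≤ M * |(x : ℝ) - (y : ℝ)| ^ α) :
    IsC1HolderDiffeo α ψ := by
  have hqA : Integrable (fun p => q (A p)) μ := hA.integrable_comp_of_integrable hq
  -- Change of variables: ψ(H x) = H(φ x) is the mass of {P ≤ φ x}, whose preimage under the
  -- measure-preserving map A is {P ≤ x}.
  have hψint : ∀ x, (ψ (H x) : ℝ) = ∫ p in P ⁻¹' Iic x, q (A p) ∂μ := by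
    intro x
    rw [← hψ, hH, ← hA.setIntegral_preimage_emb hAe]
    congr 2
    ext p
    simp [hAP, hφ.le_iff_le]
  have hM0 : 0 ≤ M := by
    have := (abs_nonneg _).trans (hM 0 1)
    simpa using this
  -- Both endpoints are allowed as base point z, so that increments to the right and to the left are
  -- covered.
  have key : ∀ x y : unitInterval, x ≤ y → ∀ z : unitInterval, (z = x ∨ z = y) →
      |((ψ (H y) : ℝ) - ψ (H x)) - G (H z) * ((H y : ℝ) - H x)| ≤
        M * |(H y : ℝ) - H x| ^ α * ((H y : ℝ) - H x) := by
    intro x y hxy z hz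
    rw [hψint, hψint, setIntegral_Ioc_preimage hP hqA hxy]
    rw [show (H y : ℝ) - H x = ∫ p in P ⁻¹' Ioc x y, q p ∂μ by
      rw [hH, hH, setIntegral_Ioc_preimage hP hq hxy]]
    rw [← integral_const_mul, ← integral_const_mul, ← integral_sub hqA.integrableOn
      (hq.integrableOn.const_mul _), ← Real.norm_eq_abs]
    refine norm_integral_le_of_norm_le (hq.integrableOn.const_mul _) ?_
    refine (ae_restrict_iff' (hP measurableSet_Ioc)).2 (Eventually.of_forall fun p hp => ?_)
    rw [hG, ← sub_mul, norm_mul, Real.norm_eq_abs, Real.norm_eq_abs, abs_of_nonneg (hq0 p)]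
    refine mul_le_mul_of_nonneg_right ((hM _ _).trans ?_) (hq0 p)
    refine mul_le_mul_of_nonneg_left ?_ hM0
    refine Real.rpow_le_rpow (abs_nonneg _) ?_ hα.le
    rw [show ∫ p in P ⁻¹' Ioc x y, q p ∂μ = (H y : ℝ) - H x by
      rw [hH, hH, setIntegral_Ioc_preimage hP hq hxy]]
    have h1 : (H x : ℝ) ≤ H (P p) := hHmono.monotone hp.1.le
    have h2 : (H (P p) : ℝ) ≤ H y := hHmono.monotone hp.2
    rw [abs_of_nonneg (by linarith : (0 : ℝ) ≤ (H y : ℝ) - H x), abs_le]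
    rcases hz with rfl | rfl <;> constructor <;> linarith
  have key2 : ∀ u w : unitInterval,
      |((ψ w : ℝ) - ψ u) - G u * ((w : ℝ) - u)| ≤ M * |(w : ℝ) - u| ^ α * |(w : ℝ) - u| := by
    intro u w
    obtain ⟨x, rfl⟩ := H.surjective u
    obtain ⟨y, rfl⟩ := H.surjective w
    rcases le_total x y with h | h
    · have := key x y h x (Or.inl rfl)
      rwa [← abs_of_nonneg (sub_nonneg.2 (hHmono.monotone h) : (0 : ℝ) ≤ (H y : ℝ) - H x),
        abs_abs, abs_of_nonneg (sub_nonneg.2 (hHmono.monotone h) : (0 : ℝ) ≤ (H y : ℝ) - H x)]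
        at this ⊢
    · have := key y x h x (Or.inr rfl)
      have h0 : (0 : ℝ) ≤ (H x : ℝ) - H y := sub_nonneg.2 (hHmono.monotone h)
      rw [abs_sub_comm (H y : ℝ), abs_of_nonneg h0]
      rw [abs_of_nonneg h0, ← abs_neg] at this
      convert this using 2
      ring
  refine ⟨G, fun x => ⟨hGpos x, ?_⟩, M, hM⟩
  rw [hasDerivWithinAt_iff_isLittleO]
  refine Asymptotics.isLittleO_iff.2 fun c hc => ?_
  have hlim : Tendsto (fun t : ℝ => M * |t - x| ^ α) (𝓝[Icc 0 1] (x : ℝ)) (𝓝 0) := by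
    have hcont : Continuous fun t : ℝ => M * |t - x| ^ α :=
      continuous_const.mul ((continuous_abs.comp (continuous_id.sub continuous_const)).rpow_const
        fun _ => Or.inr hα.le)
    have := hcont.tendsto (x : ℝ)
    simp only [sub_self, abs_zero, Real.zero_rpow hα.ne', mul_zero] at this
    exact this.mono_left nhdsWithin_le_nhds
  filter_upwards [hlim.eventually_lt_const hc, self_mem_nhdsWithin] with t ht htI
  have h := key2 x ⟨t, htI⟩
  rw [projIcc_of_mem _ htI, projIcc_val, smul_eq_mul, Real.norm_eq_abs, Real.norm_eq_abs,
    mul_comm (t - x : ℝ)]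
  exact h.trans (mul_le_mul_of_nonneg_right ht.le (abs_nonneg _))

end Conjugation

/-! ### Estimates for the density ratio on one line -/

section Estimates

/-- For an exponent in [0,1] the power lies between 1 and x. -/
theorem abs_rpow_sub_one_le {x m : ℝ} (hx : 0 < x) (hm0 : 0 ≤ m) (hm1 : m ≤ 1) :
    |x ^ m - 1| ≤ |x - 1| := by
  rcases le_total 1 x with h | h
  · have h1 : 1 ≤ x ^ m := Real.one_le_rpow h hm0
    have h2 : x ^ m ≤ x := by
      simpa using Real.rpow_le_rpow_of_exponent_le h hm1
    rw [abs_of_nonneg (by linarith), abs_of_nonneg (by linarith)]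
    linarith
  · have h1 : x ^ m ≤ 1 := Real.rpow_le_one hx.le h hm0
    have h2 : x ≤ x ^ m := by
      simpa using Real.rpow_le_rpow_of_exponent_ge hx h hm1
    rw [abs_of_nonpos (by linarith), abs_of_nonpos (by linarith)]
    linarith

variable {a b c K ε : ℝ}

/-- In these estimates a and b are the spreads over v and over its image, c is the shift, and ε will
be 1/`level v`. Here t² ≤ 2(t + c)² + 2c², and both c² and a² are at most K⁴b², whence 2 + 3 = 5. -/
theorem sq_add_sq_le_of_comparable (ha : 0 < a) (hK : 1 ≤ K) (hε1 : ε ≤ 1)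
    (hc : |c| ≤ K * a * ε) (hab : a ≤ K * b) (t : ℝ) :
    t ^ 2 + a ^ 2 ≤ 5 * K ^ 4 * ((t + c) ^ 2 + b ^ 2) := by
  have hcK : |c| ≤ K * a := hc.trans (mul_le_of_le_one_right (by positivity) hε1)
  have hc2 : c ^ 2 ≤ (K * a) ^ 2 := sq_le_sq' (by linarith [neg_abs_le c]) ((le_abs_self c).trans hcK)
  have ha2 : a ^ 2 ≤ (K * b) ^ 2 := pow_le_pow_left₀ ha.le hab 2
  have hK2 : 1 ≤ K ^ 2 := one_le_pow₀ hK
  have hK4 : K ^ 2 ≤ K ^ 4 := pow_le_pow_right₀ hK (by norm_num)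
  have ht : t ^ 2 ≤ 2 * (t + c) ^ 2 + 2 * c ^ 2 := by nlinarith [sq_nonneg (t + 2 * c)]
  have h1 : (K * a) ^ 2 ≤ K ^ 4 * b ^ 2 := by
    calc (K * a) ^ 2 = K ^ 2 * a ^ 2 := by ring
      _ ≤ K ^ 2 * (K * b) ^ 2 := by gcongr
      _ = K ^ 4 * b ^ 2 := by ring
  have h2 : (K * b) ^ 2 ≤ K ^ 4 * b ^ 2 := by
    rw [mul_pow]
    gcongr
  have h3 : 2 * (t + c) ^ 2 ≤ 5 * K ^ 4 * (t + c) ^ 2 := by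
    gcongr
    linarith
  nlinarith [sq_nonneg b]

theorem abs_sq_sub_sq_le (ha : 0 < a) (hK : 1 ≤ K) (hε1 : ε ≤ 1)
    (hba : |b - a| ≤ K * a * ε) : |b ^ 2 - a ^ 2| ≤ 3 * K ^ 2 * a ^ 2 * ε := by
  have h0 : |b - a| ≤ K * a := hba.trans (mul_le_of_le_one_right (by positivity) hε1)
  have h1 : |b + a| ≤ 3 * K * a := by
    have : b + a = (b - a) + 2 * a := by ring
    rw [this]
    refine (abs_add_le _ _).trans ?_
    rw [abs_of_pos (by linarith : 0 < 2 * a)]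
    nlinarith
  calc |b ^ 2 - a ^ 2| = |b + a| * |b - a| := by rw [← abs_mul]; congr 1; ring
    _ ≤ (3 * K * a) * (K * a * ε) := by gcongr
    _ = _ := by ring

/-- The t² terms cancel, leaving a function affine in t whose coefficients are small with ε. -/
theorem abs_quadratic_sub_le (ha : 0 < a) (hK : 1 ≤ K) (hε0 : 0 ≤ ε) (hε1 : ε ≤ 1)
    (hc : |c| ≤ K * a * ε) (hba : |b - a| ≤ K * a * ε) (t : ℝ) :
    |(t ^ 2 + a ^ 2) - ((t + c) ^ 2 + b ^ 2)| ≤ 6 * K ^ 2 * a * ε * (|t| + a) := by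
  have h1 := abs_sq_sub_sq_le ha hK hε1 hba
  have hcK : |c| ≤ K * a := hc.trans (mul_le_of_le_one_right (by positivity) hε1)
  have h2 : |c ^ 2| ≤ K ^ 2 * a ^ 2 * ε := by
    calc |c ^ 2| = |c| * |c| := by rw [sq, abs_mul]
      _ ≤ (K * a) * (K * a * ε) := by gcongr
      _ = _ := by ring
  have h3 : |2 * t * c| ≤ 2 * K ^ 2 * a * ε * |t| := by
    have : K * a * ε ≤ K ^ 2 * a * ε := by
      gcongr
      nlinarith
    calc |2 * t * c| = 2 * |t| * |c| := by rw [abs_mul, abs_mul, abs_two]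
      _ ≤ 2 * |t| * (K ^ 2 * a * ε) := by gcongr; exact hc.trans this
      _ = _ := by ring
  have h4 : (t ^ 2 + a ^ 2) - ((t + c) ^ 2 + b ^ 2) = -(2 * t * c + c ^ 2 + (b ^ 2 - a ^ 2)) := by
    ring
  rw [h4, abs_neg]
  refine (abs_add_three _ _ _).trans ?_
  have h5 : 0 ≤ K ^ 2 * a * ε * |t| := by positivity
  have h6 : 0 ≤ K ^ 2 * a ^ 2 * ε := by positivity
  nlinarith

theorem abs_mul_le_sq_add_sq (t a : ℝ) : 2 * (|t| * |a|) ≤ t ^ 2 + a ^ 2 := by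
  nlinarith [sq_nonneg (|t| - |a|), sq_abs t, sq_abs a]

/-- The ratio of the densities `(t ^ 2 + a ^ 2)⁻ᵐ` at corresponding points. -/
noncomputable def densityRatio (m a b c t : ℝ) : ℝ :=
  ((t ^ 2 + a ^ 2) / ((t + c) ^ 2 + b ^ 2)) ^ m

theorem densityRatio_pos (m : ℝ) (ha : 0 < a) (hb : 0 < b) (c t : ℝ) :
    0 < densityRatio m a b c t := by
  unfold densityRatio
  positivity

theorem abs_densityRatio_sub_one_le' {m : ℝ} (hm0 : 0 ≤ m) (hm1 : m ≤ 1) (ha : 0 < a) (hb : 0 < b)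
    (hK : 1 ≤ K) (hε0 : 0 ≤ ε) (hε1 : ε ≤ 1) (hc : |c| ≤ K * a * ε) (hba : |b - a| ≤ K * a * ε)
    (hab : a ≤ K * b) (t : ℝ) :
    |densityRatio m a b c t - 1| ≤
      30 * K ^ 6 * ε * (a * (|t| + a) / (t ^ 2 + a ^ 2)) := by
  have hA : 0 < t ^ 2 + a ^ 2 := by positivity
  have hB : 0 < (t + c) ^ 2 + b ^ 2 := by positivity
  refine (abs_rpow_sub_one_le (by positivity) hm0 hm1).trans ?_
  rw [div_sub_one hB.ne', abs_div, abs_of_pos hB, div_le_iff₀ hB]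
  refine (abs_quadratic_sub_le ha hK hε0 hε1 hc hba t).trans ?_
  have h := sq_add_sq_le_of_comparable ha hK hε1 hc hab t
  calc 6 * K ^ 2 * a * ε * (|t| + a)
      = 6 * K ^ 2 * a * ε * (|t| + a) / (t ^ 2 + a ^ 2) * (t ^ 2 + a ^ 2) := by
        field_simp
    _ ≤ 6 * K ^ 2 * a * ε * (|t| + a) / (t ^ 2 + a ^ 2) *
        (5 * K ^ 4 * ((t + c) ^ 2 + b ^ 2)) := by gcongr
    _ = _ := by ring

theorem abs_densityRatio_sub_one_le {m : ℝ} (hm0 : 0 ≤ m) (hm1 : m ≤ 1) (ha : 0 < a) (hb : 0 < b)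
    (hK : 1 ≤ K) (hε0 : 0 ≤ ε) (hε1 : ε ≤ 1) (hc : |c| ≤ K * a * ε) (hba : |b - a| ≤ K * a * ε)
    (hab : a ≤ K * b) (t : ℝ) :
    |densityRatio m a b c t - 1| ≤ 60 * K ^ 6 * ε := by
  refine (abs_densityRatio_sub_one_le' hm0 hm1 ha hb hK hε0 hε1 hc hba hab t).trans ?_
  have hA : 0 < t ^ 2 + a ^ 2 := by positivity
  have : a * (|t| + a) / (t ^ 2 + a ^ 2) ≤ 2 := by
    rw [div_le_iff₀ hA]
    have := abs_mul_le_sq_add_sq t a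
    rw [abs_of_pos ha] at this
    nlinarith [sq_nonneg t]
  calc _ ≤ 30 * K ^ 6 * ε * 2 := by gcongr
    _ = _ := by ring

/-- The refined bound on the ratio minus 1 decays like 1/|t|. -/
theorem tendsto_densityRatio {m : ℝ} (hm0 : 0 ≤ m) (hm1 : m ≤ 1) (ha : 0 < a) (hb : 0 < b)
    (hK : 1 ≤ K) (hε0 : 0 ≤ ε) (hε1 : ε ≤ 1) (hc : |c| ≤ K * a * ε) (hba : |b - a| ≤ K * a * ε)
    (hab : a ≤ K * b) {l : Filter ℝ} (hl : Tendsto (fun t => |t|) l atTop) :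
    Tendsto (densityRatio m a b c) l (𝓝 1) := by
  rw [tendsto_iff_norm_sub_tendsto_zero]
  have hlim : Tendsto (fun t : ℝ => 30 * K ^ 6 * ε * (2 * a) * |t|⁻¹) l (𝓝 0) := by
    simpa using (tendsto_inv_atTop_zero.comp hl).const_mul (30 * K ^ 6 * ε * (2 * a))
  refine squeeze_zero' (Eventually.of_forall fun t => norm_nonneg _) ?_ hlim
  filter_upwards [hl.eventually_gt_atTop a] with t ht
  refine (abs_densityRatio_sub_one_le' hm0 hm1 ha hb hK hε0 hε1 hc hba hab t).trans ?_
  have ht0 : 0 < |t| := ha.trans ht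
  have hA : 0 < t ^ 2 + a ^ 2 := by positivity
  rw [mul_assoc (30 * K ^ 6 * ε)]
  refine mul_le_mul_of_nonneg_left ?_ (by positivity)
  rw [div_le_iff₀ hA, mul_assoc, mul_assoc, ← div_eq_inv_mul, ← mul_div_assoc, ← mul_div_assoc,
    le_div_iff₀ ht0, ← sq_abs t]
  nlinarith [mul_pos ha ht0, mul_pos ha (mul_pos ha ha), mul_pos (mul_pos ha ht0) ht0,
    mul_pos (mul_pos ha ht0) (sub_pos.2 ht)]

/-- This is the numerator of the derivative of the quotient. Its cubic terms cancel, and each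
remaining term contains c or b² - a², which supplies the factor ε. -/
theorem abs_wronskian_le (ha : 0 < a) (hK : 1 ≤ K) (hε0 : 0 ≤ ε) (hε1 : ε ≤ 1)
    (hc : |c| ≤ K * a * ε) (hba : |b - a| ≤ K * a * ε) (t : ℝ) :
    |2 * t * ((t + c) ^ 2 + b ^ 2) - (t ^ 2 + a ^ 2) * (2 * (t + c))| ≤
      10 * K ^ 2 * a * ε * (t ^ 2 + a ^ 2) := by
  have h1 := abs_sq_sub_sq_le ha hK hε1 hba
  have hcK : |c| ≤ K * a := hc.trans (mul_le_of_le_one_right (by positivity) hε1)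
  have hta := abs_mul_le_sq_add_sq t a
  rw [abs_of_pos ha] at hta
  have hA : 0 < t ^ 2 + a ^ 2 := by positivity
  have e : 2 * t * ((t + c) ^ 2 + b ^ 2) - (t ^ 2 + a ^ 2) * (2 * (t + c)) =
      2 * (c * (t ^ 2 + t * c - a ^ 2) + t * (b ^ 2 - a ^ 2)) := by ring
  have h2 : |t ^ 2 + t * c - a ^ 2| ≤ 2 * K * (t ^ 2 + a ^ 2) := by
    have h3 : |t * c| ≤ K * (|t| * a) := by
      rw [abs_mul]
      calc |t| * |c| ≤ |t| * (K * a) := by gcongr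
        _ = _ := by ring
    have h4 : K * (2 * (|t| * a)) ≤ K * (t ^ 2 + a ^ 2) := by gcongr
    have h5 : t ^ 2 + a ^ 2 ≤ K * (t ^ 2 + a ^ 2) := le_mul_of_one_le_left hA.le hK
    have h6 := abs_le.1 h3
    have h7 : 0 ≤ K * (|t| * a) := by positivity
    rw [abs_le]
    constructor <;> nlinarith [sq_nonneg t, sq_nonneg a]
  rw [e, abs_mul, abs_two]
  have h3 : |c * (t ^ 2 + t * c - a ^ 2)| ≤ (K * a * ε) * (2 * K * (t ^ 2 + a ^ 2)) := by
    rw [abs_mul]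
    gcongr
  have h4 : |t * (b ^ 2 - a ^ 2)| ≤ 3 * K ^ 2 * a * ε * (|t| * a) := by
    rw [abs_mul]
    calc |t| * |b ^ 2 - a ^ 2| ≤ |t| * (3 * K ^ 2 * a ^ 2 * ε) := by gcongr
      _ = _ := by ring
  have h5 : 3 * K ^ 2 * a * ε * (2 * (|t| * a)) ≤ 3 * K ^ 2 * a * ε * (t ^ 2 + a ^ 2) := by gcongr
  have h6 := abs_add_le (c * (t ^ 2 + t * c - a ^ 2)) (t * (b ^ 2 - a ^ 2))
  have h7 : 0 ≤ K ^ 2 * a * ε * (t ^ 2 + a ^ 2) := by positivity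
  nlinarith

/-- The derivative of the density ratio is controlled by the density. -/
theorem exists_hasDerivAt_densityRatio {m : ℝ} (hm0 : 0 ≤ m) (hm1 : m ≤ 1) (ha : 0 < a)
    (hb : 0 < b) (hK : 1 ≤ K) (hε0 : 0 ≤ ε) (hε1 : ε ≤ 1) (hc : |c| ≤ K * a * ε)
    (hba : |b - a| ≤ K * a * ε) (hab : a ≤ K * b) (t : ℝ) :
    ∃ D, HasDerivAt (densityRatio m a b c) D t ∧
      |D| ≤ 250 * K ^ 10 * ε * a ^ (2 * m - 1) * (t ^ 2 + a ^ 2) ^ (-m) := by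
  have hA : 0 < t ^ 2 + a ^ 2 := by positivity
  have hB : 0 < (t + c) ^ 2 + b ^ 2 := by positivity
  set A := t ^ 2 + a ^ 2 with hAdef
  set B := (t + c) ^ 2 + b ^ 2 with hBdef
  have hAB : A ≤ 5 * K ^ 4 * B := sq_add_sq_le_of_comparable ha hK hε1 hc hab t
  have hR : 0 < A / B := div_pos hA hB
  have hRle : A / B ≤ 5 * K ^ 4 := (div_le_iff₀ hB).2 hAB
  have hA' : HasDerivAt (fun t : ℝ => t ^ 2 + a ^ 2) (2 * t) t := by
    simpa using (hasDerivAt_pow 2 t).add_const (a ^ 2)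
  have hB' : HasDerivAt (fun t : ℝ => (t + c) ^ 2 + b ^ 2) (2 * (t + c)) t := by
    simpa using (((hasDerivAt_id t).add_const c).pow 2).add_const (b ^ 2)
  have hD := ((hA'.div hB' hB.ne').rpow_const (p := m) (Or.inl hR.ne'))
  refine ⟨_, hD, ?_⟩
  have hW : |2 * t * B - A * (2 * (t + c))| ≤ 10 * K ^ 2 * a * ε * A :=
    abs_wronskian_le ha hK hε0 hε1 hc hba t
  have hRm : (A / B) ^ m ≤ 5 * K ^ 4 := by
    have hK4 : 1 ≤ 5 * K ^ 4 := by nlinarith [one_le_pow₀ hK (n := 4)]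
    calc (A / B) ^ m ≤ (5 * K ^ 4) ^ m := Real.rpow_le_rpow hR.le hRle hm0
      _ ≤ (5 * K ^ 4) ^ (1 : ℝ) := Real.rpow_le_rpow_of_exponent_le hK4 hm1
      _ = _ := Real.rpow_one _
  -- Write 1/A = A^(m-1) A^(-m) and use A ≥ a² with m - 1 ≤ 0.
  have haA : a / A ≤ a ^ (2 * m - 1) * A ^ (-m) := by
    have h1 : A ^ (m - 1) ≤ (a ^ 2) ^ (m - 1) :=
      Real.rpow_le_rpow_of_nonpos (by positivity) (by rw [hAdef]; nlinarith [sq_nonneg t])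
        (by linarith)
    have h2 : (a ^ 2) ^ (m - 1) = a ^ (2 * m - 2) := by
      rw [← Real.rpow_natCast, ← Real.rpow_mul ha.le]
      congr 1
      push_cast
      ring
    calc a / A = a * (A ^ (m - 1) * A ^ (-m)) := by
          rw [← Real.rpow_add hA, show m - 1 + -m = -1 by ring, Real.rpow_neg_one, div_eq_mul_inv]
      _ ≤ a * (a ^ (2 * m - 2) * A ^ (-m)) := by
          rw [← h2]
          gcongr
      _ = (a ^ (1 : ℝ) * a ^ (2 * m - 2)) * A ^ (-m) := by rw [Real.rpow_one]; ring
      _ = _ := by rw [← Real.rpow_add ha]; congr 2; ring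
  have hRm' : (A / B) ^ (m - 1) = (A / B) ^ m * (B / A) := by
    rw [Real.rpow_sub_one hR.ne', div_div_eq_mul_div, mul_div_assoc]
  have hfinal : |(2 * t * B - A * (2 * (t + c))) / B ^ 2 * m * (A / B) ^ (m - 1)| ≤
      10 * K ^ 2 * a * ε * A / B ^ 2 * 1 * ((5 * K ^ 4) * (B / A)) := by
    rw [abs_mul, abs_mul, abs_div, abs_of_pos (by positivity : 0 < B ^ 2), abs_of_nonneg hm0,
      abs_of_nonneg (Real.rpow_nonneg hR.le _), hRm']
    gcongr
  refine hfinal.trans ?_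
  calc 10 * K ^ 2 * a * ε * A / B ^ 2 * 1 * ((5 * K ^ 4) * (B / A))
      = 50 * K ^ 6 * ε * (a / A) * (A / B) := by field_simp; ring
    _ ≤ 50 * K ^ 6 * ε * (a ^ (2 * m - 1) * A ^ (-m)) * (5 * K ^ 4) := by gcongr
    _ = _ := by ring

end Estimates

/-! ### Weighted size on `ℤ^n` and its summability -/

section Level

variable {n : ℕ}

/-- The homogeneous size of `v`: the least `r ≥ 1` such that the `k`-th coordinate is at most
`r ^ k` in absolute value, for every `k`. -/
noncomputable def level (v : Fin n → ℤ) : ℕ :=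
  sInf {r : ℕ | 1 ≤ r ∧ ∀ k : Fin n, |v k| ≤ (r : ℤ) ^ ((k : ℕ) + 1)}

theorem level_mem (v : Fin n → ℤ) :
    1 ≤ level v ∧ ∀ k : Fin n, |v k| ≤ (level v : ℤ) ^ ((k : ℕ) + 1) := by
  refine Nat.sInf_mem (s := {r : ℕ | 1 ≤ r ∧ ∀ k : Fin n, |v k| ≤ (r : ℤ) ^ ((k : ℕ) + 1)})
    ⟨1 + ∑ k, (v k).natAbs, le_self_add, fun k => ?_⟩
  have h1 : |v k| ≤ ((1 + ∑ k, (v k).natAbs : ℕ) : ℤ) := by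
    push_cast
    have := Finset.single_le_sum (f := fun k => |v k|) (fun k _ => abs_nonneg _)
      (Finset.mem_univ k)
    linarith
  refine h1.trans (le_self_pow₀ ?_ (by omega))
  push_cast
  have := Finset.sum_nonneg (s := Finset.univ) fun k (_ : k ∈ Finset.univ) => abs_nonneg (v k)
  linarith

theorem one_le_level (v : Fin n → ℤ) : 1 ≤ level v := (level_mem v).1

/-- With the weights of `level` the growth is additive: r^(k+1) + C r^k = r^k (r + C) ≤ (r +
C)^(k+1). -/
theorem exists_level_baseAct_le (f : lowerUnitriangular (n + 1)) :
    ∃ C : ℕ, ∀ v : Fin n → ℤ, level (baseAct f v) ≤ level v + C ∧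
      |shift f v| ≤ (C : ℤ) * (level v : ℤ) ^ n := by
  obtain ⟨C, hC⟩ := exists_abs_act_sub_le f
  refine ⟨C, fun v => ?_⟩
  have hi : ∀ k : Fin (n + 1), ∀ l < k,
      |(Fin.snoc v 0 : Fin (n + 1) → ℤ) l| ≤ (level v : ℤ) ^ ((l : ℕ) + 1) := by
    intro k l hl
    induction l using Fin.lastCases with
    | last => exact absurd hl (not_lt.2 (Fin.le_last _))
    | cast l => simpa using (level_mem v).2 l
  constructor
  · refine Nat.sInf_le ⟨(one_le_level v).trans le_self_add, fun k => ?_⟩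
    have h := hC (Fin.snoc v 0) k.castSucc (level v) (one_le_level v) (hi _)
    rw [Fin.snoc_castSucc, Fin.val_castSucc] at h
    have h2 := (level_mem v).2 k
    have h3 : |baseAct f v k| ≤ |baseAct f v k - v k| + |v k| := by
      simpa using abs_add_le (baseAct f v k - v k) (v k)
    push_cast
    calc |baseAct f v k| ≤ (C : ℤ) * (level v : ℤ) ^ (k : ℕ) + (level v : ℤ) ^ ((k : ℕ) + 1) :=
          h3.trans (add_le_add h h2)
      _ = (level v : ℤ) ^ (k : ℕ) * (level v + C) := by ring
      _ ≤ ((level v : ℤ) + C) ^ (k : ℕ) * (level v + C) := by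
          gcongr
          linarith
      _ = _ := by ring
  · have h := hC (Fin.snoc v 0) (Fin.last n) (level v) (one_le_level v) (hi _)
    simpa [shift] using h

theorem summable_prod_pi {g : ℤ → ℝ} (hg : Summable g) (hg0 : ∀ x, 0 ≤ g x) (n : ℕ) :
    Summable fun v : Fin n → ℤ => ∏ k, g (v k) := by
  induction n with
  | zero => exact Summable.of_finite
  | succ n ih =>
    rw [← (Fin.consEquiv fun _ : Fin (n + 1) => ℤ).summable_iff]
    have h := hg.mul_of_nonneg ih hg0 fun v => Finset.prod_nonneg fun k _ => hg0 (v k)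
    refine h.congr fun p => ?_
    simp [Fin.prod_univ_succ, Fin.consEquiv]

theorem summable_max_one_abs_rpow {e : ℝ} (he : 1 < e) :
    Summable fun x : ℤ => (max 1 |(x : ℝ)|) ^ (-e) := by
  refine Summable.of_nonneg_of_le (fun x => by positivity) (fun x => ?_)
    ((Real.summable_abs_int_rpow he).add (hasSum_ite_eq (0 : ℤ) (1 : ℝ)).summable)
  by_cases hx : x = 0
  · subst hx
    simp [Real.zero_rpow (by linarith : -e ≠ 0)]
  · have : (1 : ℝ) ≤ |(x : ℝ)| := by exact_mod_cast Int.one_le_abs hx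
    simp [hx, max_eq_right this]

/-- Since 1 + … + n = n(n + 1)/2, the exponent β splits as e times the sum of the weights with e >
1. Each factor is then at most max(1, |v k|)^(-e), and the product of these one-variable series
converges. -/
theorem summable_level_rpow (hn : 1 ≤ n) {β : ℝ} (hβ : (n : ℝ) * (n + 1) / 2 < β) :
    Summable fun v : Fin n → ℤ => (level v : ℝ) ^ (-β) := by
  have hn' : (1 : ℝ) ≤ n := by exact_mod_cast hn
  have hD : (0 : ℝ) < (n : ℝ) * (n + 1) / 2 := by positivity
  set e := β / ((n : ℝ) * (n + 1) / 2) with he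
  have he1 : 1 < e := (one_lt_div hD).2 hβ
  have hsum : ∑ k : Fin n, (((k : ℕ) : ℝ) + 1) = (n : ℝ) * (n + 1) / 2 := by
    rw [Fin.sum_univ_eq_sum_range (fun k => (k : ℝ) + 1) n]
    clear! e
    clear hD hβ hn' hn
    induction n with
    | zero => simp
    | succ n ih => rw [Finset.sum_range_succ, ih]; push_cast; ring
  refine Summable.of_nonneg_of_le (fun v => by positivity) (fun v => ?_)
    (summable_prod_pi (summable_max_one_abs_rpow he1) (fun x => by positivity) n)
  have hr : (1 : ℝ) ≤ level v := by exact_mod_cast one_le_level v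
  have hexp : -β = ∑ k : Fin n, (((k : ℕ) : ℝ) + 1) * (-e) := by
    rw [← Finset.sum_mul, hsum, he]
    field_simp
  rw [hexp, Real.rpow_sum_of_pos (by linarith)]
  refine Finset.prod_le_prod (fun k _ => by positivity) fun k _ => ?_
  rw [Real.rpow_mul (by linarith)]
  refine Real.rpow_le_rpow_of_nonpos (by positivity) ?_ (by linarith)
  have h1 : ((level v : ℝ)) ^ (((k : ℕ) : ℝ) + 1) = (level v : ℝ) ^ ((k : ℕ) + 1) := by
    rw [← Real.rpow_natCast]
    push_cast
    rfl
  rw [h1]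
  refine max_le (one_le_pow₀ hr) ?_
  exact_mod_cast (level_mem v).2 k

end Level

/-! ### Hölder gluing and interpolation -/

section Gluing

variable {ι : Type*} {Y : ι × ℝ → unitInterval} {D : ι × ℝ → ℝ} {α M : ℝ}

/-- The point y lies on one side of the whole interval; let s run to the end on that side, where D
tends to 1 while Y (v, s) stays between Y (v, t) and y. -/
theorem abs_sub_one_le_of_notMem_fiber (hα : 0 < α) (hM : 0 ≤ M)
    (hmono : ∀ v, StrictMono fun t => Y (v, t)) (hcont : ∀ v, Continuous fun t => Y (v, t))
    (hD : ∀ v s t, |D (v, s) - D (v, t)| ≤ M * |(Y (v, s) : ℝ) - Y (v, t)| ^ α)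
    (htop : ∀ v, Tendsto (fun t => D (v, t)) atTop (𝓝 1))
    (hbot : ∀ v, Tendsto (fun t => D (v, t)) atBot (𝓝 1)) (v : ι) (t : ℝ) {y : unitInterval}
    (hy : y ∉ range fun s => Y (v, s)) :
    |D (v, t) - 1| ≤ M * |(Y (v, t) : ℝ) - y| ^ α := by
  have hside : (∀ s, Y (v, s) < y) ∨ ∀ s, y < Y (v, s) := by
    by_contra! hcon
    obtain ⟨⟨a, ha⟩, b, hb⟩ := hcon
    exact hy (mem_range_of_exists_le_of_exists_ge (hcont v) ⟨b, hb⟩ ⟨a, ha⟩)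
  rcases hside with h | h
  · refine le_of_tendsto ((tendsto_const_nhds.sub (htop v)).abs) ?_
    filter_upwards [eventually_ge_atTop t] with s hs
    refine (hD v t s).trans ?_
    have h1 : (Y (v, t) : ℝ) ≤ Y (v, s) := (hmono v).monotone hs
    have h2 : (Y (v, s) : ℝ) < y := h s
    gcongr M * ?_ ^ α
    rw [abs_of_nonpos (by linarith), abs_of_nonpos (by linarith)]
    linarith
  · refine le_of_tendsto ((tendsto_const_nhds.sub (hbot v)).abs) ?_
    filter_upwards [eventually_le_atBot t] with s hs
    refine (hD v t s).trans ?_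
    have h1 : (Y (v, s) : ℝ) ≤ Y (v, t) := (hmono v).monotone hs
    have h2 : (y : ℝ) < Y (v, s) := h s
    gcongr M * ?_ ^ α
    rw [abs_of_nonneg (by linarith), abs_of_nonneg (by linarith)]
    linarith

/-- A function on disjoint open intervals which is uniformly Hölder on each of them and tends to
`1` at their ends extends by `1` to a Hölder function on `[0,1]`. -/
theorem exists_holder_extension (hα : 0 < α) (hM : 0 ≤ M) (hinj : Function.Injective Y)
    (hmono : ∀ v, StrictMono fun t => Y (v, t)) (hcont : ∀ v, Continuous fun t => Y (v, t))
    (hpos : ∀ p, 0 < D p)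
    (hD : ∀ v s t, |D (v, s) - D (v, t)| ≤ M * |(Y (v, s) : ℝ) - Y (v, t)| ^ α)
    (htop : ∀ v, Tendsto (fun t => D (v, t)) atTop (𝓝 1))
    (hbot : ∀ v, Tendsto (fun t => D (v, t)) atBot (𝓝 1)) :
    ∃ G : unitInterval → ℝ, (∀ p, G (Y p) = D p) ∧ (∀ y, 0 < G y) ∧
      ∀ x y : unitInterval, |G x - G y| ≤ 2 * M * |(x : ℝ) - y| ^ α := by
  have hG : ∀ p, Function.extend Y D (fun _ => 1) (Y p) = D p := fun p => hinj.extend_apply D _ p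
  have hG' : ∀ y, y ∉ range Y → Function.extend Y D (fun _ => 1) y = 1 := fun y hy =>
    Function.extend_apply' D _ y hy
  refine ⟨Function.extend Y D (fun _ => 1), hG, fun y => ?_, ?_⟩
  · by_cases hy : y ∈ range Y
    · obtain ⟨p, rfl⟩ := hy
      rw [hG]
      exact hpos p
    · rw [hG' y hy]
      exact one_pos
  -- Two points not on a common line are compared through the value 1, which produces the factor 2.
  have key : ∀ x y : unitInterval, (∃ v s t, x = Y (v, s) ∧ y = Y (v, t)) ∨
      |Function.extend Y D (fun _ => 1) x - 1| ≤ M * |(x : ℝ) - y| ^ α := by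
    intro x y
    by_cases hx : x ∈ range Y
    · obtain ⟨⟨v, s⟩, rfl⟩ := hx
      by_cases hy : y ∈ range fun t => Y (v, t)
      · obtain ⟨t, rfl⟩ := hy
        exact Or.inl ⟨v, s, t, rfl, rfl⟩
      · right
        rw [hG]
        exact abs_sub_one_le_of_notMem_fiber hα hM hmono hcont hD htop hbot v s hy
    · right
      rw [hG' x hx, sub_self, abs_zero]
      positivity
  intro x y
  rcases key x y with ⟨v, s, t, rfl, rfl⟩ | hx
  · rw [hG, hG]
    refine (hD v s t).trans ?_
    gcongr
    linarith
  rcases key y x with ⟨v, s, t, rfl, rfl⟩ | hy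
  · rw [hG, hG]
    refine (hD v t s).trans ?_
    gcongr
    linarith
  rw [abs_sub_comm (y : ℝ)] at hy
  have := abs_sub_le (Function.extend Y D (fun _ => 1) x) 1 (Function.extend Y D (fun _ => 1) y)
  rw [abs_sub_comm 1] at this
  linarith

/-- Both B∫q - F and B∫q + F have nonnegative derivative. -/
theorem abs_sub_le_mul_integral {F q : ℝ → ℝ} (hq : Continuous q) {B : ℝ}
    (h : ∀ t, ∃ F', HasDerivAt F F' t ∧ |F'| ≤ B * q t) {s t : ℝ} (hst : s ≤ t) :
    |F t - F s| ≤ B * ∫ u in s..t, q u := by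
  choose F' hF' hle using h
  have hX : ∀ u, HasDerivAt (fun u => ∫ x in s..u, q x) (q u) u := fun u =>
    (hq.integral_hasStrictDerivAt s u).hasDerivAt
  have h1 : Monotone fun u => B * (∫ x in s..u, q x) - F u :=
    monotone_of_hasDerivAt_nonneg (fun u => ((hX u).const_mul B).sub (hF' u))
      fun u => sub_nonneg.2 ((le_abs_self _).trans (hle u))
  have h2 : Monotone fun u => B * (∫ x in s..u, q x) + F u :=
    monotone_of_hasDerivAt_nonneg (fun u => ((hX u).const_mul B).add (hF' u))
      fun u => by
        have := (neg_abs_le (F' u))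
        have := hle u
        simp only [Pi.zero_apply]
        linarith
  have h1' := h1 hst
  have h2' := h2 hst
  simp only [intervalIntegral.integral_same, mul_zero] at h1' h2'
  rw [abs_le]
  constructor <;> linarith

theorem abs_le_rpow_mul_rpow {x S T : ℝ} (hα : 0 ≤ α) (hα1 : α ≤ 1) (hS : |x| ≤ S)
    (hT : |x| ≤ T) : |x| ≤ S ^ (1 - α) * T ^ α := by
  rcases eq_or_lt_of_le (abs_nonneg x) with h | h
  · rw [← h] at hS hT ⊢
    positivity
  · calc |x| = |x| ^ (1 - α) * |x| ^ α := by
          rw [← Real.rpow_add h, sub_add_cancel, Real.rpow_one]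
      _ ≤ S ^ (1 - α) * T ^ α := by
          have := sub_nonneg.2 hα1
          have := h.le.trans hS
          gcongr

end Gluing

/-! ### The invariant measure of the skew product -/

section SkewMeasure

variable {n : ℕ}

theorem measurePreserving_baseAct (f : lowerUnitriangular (n + 1)) :
    MeasurePreserving (baseAct f) (Measure.count : Measure (Fin n → ℤ)) Measure.count := by
  refine ⟨measurable_of_countable _, Measure.ext_iff_singleton.2 fun w => ?_⟩
  have h : baseAct f ⁻¹' {w} = {baseAct f⁻¹ w} := by
    ext v
    rw [mem_preimage, mem_singleton_iff, mem_singleton_iff]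
    constructor
    · rintro rfl
      rw [← baseAct_mul, inv_mul_cancel, baseAct_one]
    · rintro rfl
      rw [← baseAct_mul, mul_inv_cancel, baseAct_one]
  rw [Measure.map_apply (measurable_of_countable _) (measurableSet_singleton w), h,
    Measure.count_singleton, Measure.count_singleton]

/-- The reference measure on `ℤ^n × ℝ`. -/
noncomputable def refMeasure (n : ℕ) : Measure ((Fin n → ℤ) × ℝ) :=
  (Measure.count : Measure (Fin n → ℤ)).prod volume

theorem measurePreserving_skew (f : lowerUnitriangular (n + 1)) :
    MeasurePreserving (skew f) (refMeasure n) (refMeasure n) := by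
  refine (measurePreserving_baseAct f).skew_product
    (g := fun v t => t + (shift f v : ℝ)) ?_ (ae_of_all _ fun v => ?_)
  · exact measurable_from_prod_countable_right fun v =>
      (measurable_id.add_const (shift f v : ℝ) : Measurable fun t : ℝ => t + shift f v)
  · exact map_add_right_eq_self volume _

theorem measurableEmbedding_skew (f : lowerUnitriangular (n + 1)) :
    MeasurableEmbedding (skew f) :=
  MeasurableEquiv.measurableEmbedding
    { toFun := skew f
      invFun := skew f⁻¹
      left_inv := fun p => by rw [← skew_mul, inv_mul_cancel, skew_one]
      right_inv := fun p => by rw [← skew_mul, mul_inv_cancel, skew_one]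
      measurable_toFun := (measurePreserving_skew f).measurable
      measurable_invFun := (measurePreserving_skew f⁻¹).measurable }

theorem refMeasure_singleton_prod (v : Fin n → ℤ) (s : Set ℝ) :
    refMeasure n ({v} ×ˢ s) = volume s := by
  rw [refMeasure, Measure.prod_prod, Measure.count_singleton, one_mul]

theorem setIntegral_refMeasure_singleton_prod {q : (Fin n → ℤ) × ℝ → ℝ}
    (hq : Integrable q (refMeasure n)) (v : Fin n → ℤ) {s t : ℝ} (hst : s ≤ t) :
    ∫ p in {v} ×ˢ Ioc s t, q p ∂refMeasure n = ∫ u in s..t, q (v, u) := by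
  rw [refMeasure, setIntegral_prod _ hq.integrableOn, integral_singleton,
    count_real_singleton, one_smul, intervalIntegral.integral_of_le hst]

namespace IsLexEmbedding

variable {P : (Fin n → ℤ) × ℝ → unitInterval}

theorem refMeasure_preimage_singleton (hP : IsLexEmbedding P) (x : unitInterval) :
    refMeasure n (P ⁻¹' {x}) = 0 := by
  by_cases h : x ∈ range P
  · obtain ⟨⟨v, t⟩, rfl⟩ := h
    have : P ⁻¹' {P (v, t)} = {v} ×ˢ {t} := by
      rw [singleton_prod_singleton]
      exact hP.injective.preimage_image {(v, t)} ▸ by rw [image_singleton]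
    rw [this, refMeasure_singleton_prod, Real.volume_singleton]
  · rw [preimage_singleton_eq_empty.2 h, measure_empty]

theorem refMeasure_preimage_Ioc_pos (hP : IsLexEmbedding P) {x y : unitInterval} (hxy : x < y) :
    0 < refMeasure n (P ⁻¹' Ioc x y) := by
  -- The first point starts a segment of its line; the second leaves room above it before y.
  obtain ⟨_, ⟨⟨v, s⟩, rfl⟩, hx, hy⟩ := hP.denseRange.exists_between hxy
  obtain ⟨_, ⟨⟨w, t⟩, rfl⟩, hs, ht⟩ := hP.denseRange.exists_between hy
  obtain ⟨r, hr, hsub⟩ : ∃ r, s < r ∧ ∀ u ∈ Ioo s r, P (v, u) < P (w, t) := by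
    rcases hP.lt_iff.1 hs with h | ⟨h, h'⟩
    · exact ⟨s + 1, by linarith, fun u _ => hP.lt_of_base_lt u t h⟩
    · exact ⟨t, h', fun u hu => hP.lt_iff.2 (Or.inr ⟨h, hu.2⟩)⟩
  have hss : {v} ×ˢ Ioo s r ⊆ P ⁻¹' Ioc x y := by
    rintro ⟨v', u⟩ ⟨hv, hu⟩
    obtain rfl : v' = v := hv
    exact ⟨hx.trans (hP.strictMono v' hu.1), ((hsub u hu).trans ht).le⟩
  refine lt_of_lt_of_le ?_ (measure_mono hss)
  rw [refMeasure_singleton_prod, Real.volume_Ioo]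
  exact ENNReal.ofReal_pos.2 (sub_pos.2 hr)

theorem preimage_Ioc (hP : IsLexEmbedding P) (v : Fin n → ℤ) (s t : ℝ) :
    P ⁻¹' Ioc (P (v, s)) (P (v, t)) = {v} ×ˢ Ioc s t := by
  ext ⟨w, u⟩
  simp only [mem_preimage, mem_Ioc, mem_prod, mem_singleton_iff]
  constructor
  · rintro ⟨h1, h2⟩
    obtain rfl : w = v := by
      rcases lt_trichotomy (toLex w) (toLex v) with h | h | h
      · exact absurd h1 (hP.lt_of_base_lt u s h).not_gt
      · exact toLex_inj.1 h
      · exact absurd h2 (hP.lt_of_base_lt t u h).not_ge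
    exact ⟨rfl, (hP.strictMono w).lt_iff_lt.1 h1, (hP.strictMono w).le_iff_le.1 h2⟩
  · rintro ⟨rfl, h1, h2⟩
    exact ⟨hP.strictMono w h1, (hP.strictMono w).monotone h2⟩

end IsLexEmbedding

end SkewMeasure

/-! ### The density: integrability and variation of the spread -/

section Density

variable {n : ℕ}

/-- The spread of the density over the base point `v`. -/
noncomputable def spread (s : ℕ) (v : Fin n → ℤ) : ℝ := (level v : ℝ) ^ s

theorem one_le_spread (s : ℕ) (v : Fin n → ℤ) : 1 ≤ spread s v :=
  one_le_pow₀ (by exact_mod_cast one_le_level v)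

theorem spread_pos (s : ℕ) (v : Fin n → ℤ) : 0 < spread s v :=
  one_pos.trans_le (one_le_spread s v)

/-- The (unnormalized) density on `ℤ^n × ℝ`. -/
noncomputable def density (m : ℝ) (s : ℕ) (p : (Fin n → ℤ) × ℝ) : ℝ :=
  (p.2 ^ 2 + spread s p.1 ^ 2) ^ (-m)

theorem density_pos (m : ℝ) (s : ℕ) (p : (Fin n → ℤ) × ℝ) : 0 < density m s p := by
  have := spread_pos s p.1
  unfold density
  positivity

theorem continuous_density (m : ℝ) (s : ℕ) (v : Fin n → ℤ) :
    Continuous fun t => density m s (v, t) := by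
  have := spread_pos s v
  refine Continuous.rpow_const (by fun_prop) fun t => Or.inl ?_
  positivity

theorem measurable_density (m : ℝ) (s : ℕ) :
    Measurable (density m s : (Fin n → ℤ) × ℝ → ℝ) :=
  measurable_from_prod_countable_right fun v => (continuous_density m s v).measurable

theorem density_skew (m : ℝ) (s : ℕ) (f : lowerUnitriangular (n + 1)) (p : (Fin n → ℤ) × ℝ) :
    density m s (skew f p) =
      densityRatio m (spread s p.1) (spread s (baseAct f p.1)) (shift f p.1) p.2 *
        density m s p := by
  have h1 := spread_pos s p.1
  have h2 := spread_pos s (baseAct f p.1)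
  simp only [density, skew, densityRatio]
  rw [Real.div_rpow (by positivity) (by positivity), Real.rpow_neg (by positivity),
    Real.rpow_neg (by positivity)]
  have : (p.2 ^ 2 + spread s p.1 ^ 2) ^ m ≠ 0 := by positivity
  field_simp

theorem integrable_density (hn : 1 ≤ n) {m D : ℝ} {s : ℕ} (hs : 0 < s)
    (hD : (n : ℝ) * (n + 1) / 2 < D) (hm : s * (2 * m - 1) = D) :
    Integrable (density m s : (Fin n → ℤ) × ℝ → ℝ) (refMeasure n) := by
  have hs' : (0 : ℝ) < s := by exact_mod_cast hs
  obtain ⟨β, hβ, hβD⟩ := exists_between hD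
  have hβ0 : 0 < β := lt_of_le_of_lt (by positivity) hβ
  set η := (D - β) / s with hη
  have hη0 : 0 < η := div_pos (by linarith) hs'
  have hsη : s * η = D - β := by rw [hη]; field_simp
  have h1 : Integrable (fun v : Fin n → ℤ => (level v : ℝ) ^ (-β)) Measure.count := by
    rw [integrable_count_iff]
    exact (summable_level_rpow hn hβ).norm
  have h2 : Integrable (fun t : ℝ => (1 + ‖t‖ ^ 2) ^ (-(1 + η) / 2)) volume :=
    integrable_rpow_neg_one_add_norm_sq (by simpa using hη0)
  refine (h1.mul_prod h2).mono' (measurable_density m s).aestronglyMeasurable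
    (ae_of_all _ fun p => ?_)
  rw [Real.norm_eq_abs, abs_of_pos (density_pos m s p)]
  have ha := one_le_spread s p.1
  have hr : (1 : ℝ) ≤ level p.1 := by exact_mod_cast one_le_level p.1
  have hA : 0 < p.2 ^ 2 + spread s p.1 ^ 2 := by positivity
  -- Splitting the exponent separates the variables: the first power is at most `level`^(-β),
  -- summable in v, and the second at most (1 + t²)^(-(1+η)/2), integrable in t.
  have hexp : -m = -(β / (2 * s)) + -(1 + η) / 2 := by
    field_simp
    linarith
  rw [density, hexp, Real.rpow_add hA]
  have e : (level p.1 : ℝ) ^ (-β) = (spread s p.1 ^ 2) ^ (-(β / (2 * s))) := by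
    rw [spread, ← pow_mul, ← Real.rpow_natCast, ← Real.rpow_mul (by linarith)]
    congr 1
    push_cast
    field_simp
  rw [e]
  have h3 : (p.2 ^ 2 + spread s p.1 ^ 2) ^ (-(β / (2 * s))) ≤
      (spread s p.1 ^ 2) ^ (-(β / (2 * s))) :=
    Real.rpow_le_rpow_of_nonpos (by positivity) (by nlinarith [sq_nonneg p.2])
      (neg_nonpos.2 (by positivity))
  have h4 : (p.2 ^ 2 + spread s p.1 ^ 2) ^ (-(1 + η) / 2) ≤
      (1 + ‖p.2‖ ^ 2) ^ (-(1 + η) / 2) := by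
    refine Real.rpow_le_rpow_of_nonpos (by positivity) ?_ (by linarith)
    rw [Real.norm_eq_abs, sq_abs]
    nlinarith
  gcongr

/-- The level r changes by O(1), so r^s changes by O(r^(s-1)), that is, by O(spread / r). The shift
is O(r^n), which is of that order because n ≤ s - 1. -/
theorem exists_spread_bounds {s : ℕ} (hs : n + 1 ≤ s) (f : lowerUnitriangular (n + 1)) :
    ∃ K : ℝ, 1 ≤ K ∧ ∀ v : Fin n → ℤ,
      |(shift f v : ℝ)| ≤ K * spread s v * (level v : ℝ)⁻¹ ∧
      |spread s (baseAct f v) - spread s v| ≤ K * spread s v * (level v : ℝ)⁻¹ ∧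
      spread s v ≤ K * spread s (baseAct f v) := by
  obtain ⟨C₁, hC₁⟩ := exists_level_baseAct_le f
  obtain ⟨C₂, hC₂⟩ := exists_level_baseAct_le f⁻¹
  set C : ℝ := max C₁ C₂ with hC
  have hC0 : 0 ≤ C := le_max_of_le_left (Nat.cast_nonneg _)
  refine ⟨1 + C + s * C * (1 + C) ^ (s - 1) + (1 + C) ^ s, ?_, fun v => ?_⟩
  · have : 0 ≤ C + s * C * (1 + C) ^ (s - 1) + (1 + C) ^ s := by positivity
    linarith
  have hr1 : (1 : ℝ) ≤ (level v : ℝ) := by exact_mod_cast one_le_level v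
  have hr1' : (1 : ℝ) ≤ (level (baseAct f v) : ℝ) := by exact_mod_cast one_le_level (baseAct f v)
  have h1 : (level (baseAct f v) : ℝ) ≤ level v + C := by
    have : (level (baseAct f v) : ℝ) ≤ level v + C₁ := by exact_mod_cast (hC₁ v).1
    linarith [le_max_left (C₁ : ℝ) C₂]
  have h2 : (level v : ℝ) ≤ level (baseAct f v) + C := by
    have h := (hC₂ (baseAct f v)).1
    rw [← baseAct_mul, inv_mul_cancel, baseAct_one] at h
    have : (level v : ℝ) ≤ level (baseAct f v) + C₂ := by exact_mod_cast h
    linarith [le_max_right (C₁ : ℝ) C₂]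
  have hshift : |(shift f v : ℝ)| ≤ C₁ * (level v : ℝ) ^ n := by exact_mod_cast (hC₁ v).2
  rw [spread, spread]
  set r : ℝ := (level v : ℝ)
  set r' : ℝ := (level (baseAct f v) : ℝ)
  have h1' : r' ≤ (1 + C) * r := by nlinarith
  have h2' : r ≤ (1 + C) * r' := by nlinarith
  have hdiv : r ^ s * r⁻¹ = r ^ (s - 1) := by
    rw [← div_eq_mul_inv, div_eq_iff (by linarith), ← pow_succ, Nat.sub_add_cancel (by omega)]
  have hps : 0 ≤ (1 + C) ^ s := by positivity
  have hps' : 0 ≤ s * C * (1 + C) ^ (s - 1) := by positivity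
  have hrp : 0 < r ^ (s - 1) := by positivity
  refine ⟨?_, ?_, ?_⟩
  · rw [mul_assoc, hdiv]
    calc |(shift f v : ℝ)| ≤ C * r ^ (s - 1) := by
          refine hshift.trans ?_
          gcongr
          · exact le_max_left _ _
          · omega
      _ ≤ _ := by
          gcongr
          linarith
  · rw [mul_assoc, hdiv]
    have habs : |r' - r| ≤ C := abs_le.2 ⟨by linarith, by linarith⟩
    have hmax : max |r'| |r| ≤ (1 + C) * r := by
      rw [abs_of_pos (by linarith), abs_of_pos (by linarith)]
      exact max_le h1' (by nlinarith)
    calc |r' ^ s - r ^ s| ≤ |r' - r| * s * max |r'| |r| ^ (s - 1) := abs_pow_sub_pow_le _ _ _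
      _ ≤ C * s * ((1 + C) * r) ^ (s - 1) := by gcongr
      _ = (s * C * (1 + C) ^ (s - 1)) * r ^ (s - 1) := by rw [mul_pow]; ring
      _ ≤ _ := by
          gcongr
          linarith
  · calc r ^ s ≤ ((1 + C) * r') ^ s := by gcongr
      _ = (1 + C) ^ s * r' ^ s := mul_pow _ _ _
      _ ≤ _ := by
          gcongr
          linarith

end Density

/-! ### Uniform Hölder bound and conclusion -/

section Main

variable {n : ℕ}

/-- On each fiber, the density ratio is Hölder with respect to the mass of the density. -/
theorem abs_densityRatio_sub_le {m α K r : ℝ} {s : ℕ} (hm0 : 0 ≤ m) (hm1 : m ≤ 1) (hα : 0 < α)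
    (hα1 : α ≤ 1) (hm : s * (2 * m - 1) = 1 / α) (hr : 1 ≤ r) {b c : ℝ} (hb : 0 < b) (hK : 1 ≤ K)
    (hc : |c| ≤ K * r ^ s * r⁻¹) (hba : |b - r ^ s| ≤ K * r ^ s * r⁻¹) (hab : r ^ s ≤ K * b)
    (t u : ℝ) :
    |densityRatio m (r ^ s) b c t - densityRatio m (r ^ s) b c u| ≤
      250 * K ^ 10 * |∫ x in u..t, (x ^ 2 + (r ^ s) ^ 2) ^ (-m)| ^ α := by
  wlog hut : u ≤ t generalizing u t
  · rw [abs_sub_comm, intervalIntegral.integral_symm, abs_neg]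
    exact this u t (le_of_not_ge hut)
  have hr0 : 0 < r := by linarith
  have ha : 0 < r ^ s := by positivity
  have hε0 : 0 ≤ r⁻¹ := by positivity
  have hε1 : r⁻¹ ≤ 1 := inv_le_one_of_one_le₀ hr
  have hcont : Continuous fun x : ℝ => (x ^ 2 + (r ^ s) ^ 2) ^ (-m) :=
    Continuous.rpow_const (by fun_prop) fun x => Or.inl (by positivity)
  set X := ∫ x in u..t, (x ^ 2 + (r ^ s) ^ 2) ^ (-m) with hX
  have hX0 : 0 ≤ X := intervalIntegral.integral_nonneg hut fun x _ => by positivity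
  have hT : |densityRatio m (r ^ s) b c t - densityRatio m (r ^ s) b c u| ≤
      250 * K ^ 10 * r⁻¹ * (r ^ s) ^ (2 * m - 1) * X :=
    abs_sub_le_mul_integral hcont
      (exists_hasDerivAt_densityRatio hm0 hm1 ha hb hK hε0 hε1 hc hba hab) hut
  have hS : |densityRatio m (r ^ s) b c t - densityRatio m (r ^ s) b c u| ≤
      250 * K ^ 10 * r⁻¹ := by
    have h1 := abs_densityRatio_sub_one_le hm0 hm1 ha hb hK hε0 hε1 hc hba hab t
    have h2 := abs_densityRatio_sub_one_le hm0 hm1 ha hb hK hε0 hε1 hc hba hab u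
    rw [abs_sub_comm] at h2
    have h3 := abs_sub_le (densityRatio m (r ^ s) b c t) 1 (densityRatio m (r ^ s) b c u)
    have h4 : K ^ 6 * r⁻¹ ≤ K ^ 10 * r⁻¹ := by
      gcongr
      norm_num
    have h5 : 0 ≤ K ^ 10 * r⁻¹ := by positivity
    linarith
  -- In the interpolated bound this factor cancels r⁻¹, so the Hölder constant does not depend on r.
  have hpow : ((r ^ s) ^ (2 * m - 1)) ^ α = r := by
    rw [← Real.rpow_natCast, ← Real.rpow_mul hr0.le, ← Real.rpow_mul hr0.le, hm,
      one_div_mul_cancel hα.ne', Real.rpow_one]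
  refine (abs_le_rpow_mul_rpow hα.le hα1 hS hT).trans (le_of_eq ?_)
  have hL : 0 < 250 * K ^ 10 * r⁻¹ := by positivity
  rw [mul_assoc _ _ X, Real.mul_rpow hL.le (by positivity), ← mul_assoc, ← Real.rpow_add hL,
    sub_add_cancel, Real.rpow_one, Real.mul_rpow (by positivity) hX0, hpow, abs_of_nonneg hX0]
  field_simp

theorem IsFarbFranksAction.exists_conj_isC1HolderDiffeo (hn : 1 ≤ n) {α : ℝ} (hα : 0 < α)
    (hαn : (n : ℝ) * (n + 1) / 2 < 1 / α)
    {φ : lowerUnitriangular (n + 1) →* (unitInterval ≃ₜ unitInterval)}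
    (hφ : IsFarbFranksAction (n + 1) φ) :
    ∃ ψ : lowerUnitriangular (n + 1) →* (unitInterval ≃ₜ unitInterval),
      (∀ f, IsC1HolderDiffeo α (ψ f)) ∧ TopConj φ ψ := by
  obtain ⟨P, hP, hPφ⟩ := hφ.exists_isLexEmbedding
  have hα1 : α ≤ 1 := by
    have hn' : (1 : ℝ) ≤ n := by exact_mod_cast hn
    have : 1 < 1 / α := lt_of_le_of_lt (by nlinarith) hαn
    exact ((one_lt_div hα).1 this).le
  -- The bound n + 1 ≤ s controls the shift relative to the spread; 1/α ≤ s ensures m ≤ 1 below.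
  obtain ⟨s, hs, hsα⟩ : ∃ s : ℕ, n + 1 ≤ s ∧ 1 / α ≤ s := by
    obtain ⟨s, hs⟩ := exists_nat_ge (1 / α)
    exact ⟨max (n + 1) s, le_max_left _ _, hs.trans (by exact_mod_cast le_max_right _ _)⟩
  have hs0 : (0 : ℝ) < s := (one_div_pos.2 hα).trans_le hsα
  -- This m makes the mass of the line over v of order `level v`^(-1/α).
  obtain ⟨m, hm⟩ : ∃ m : ℝ, s * (2 * m - 1) = 1 / α :=
    ⟨(1 + 1 / α / s) / 2, by field_simp; ring⟩
  have hm0 : 0 ≤ m := by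
    have : 0 < s * (2 * m - 1) := by rw [hm]; positivity
    have := (mul_pos_iff_of_pos_left hs0).1 this
    linarith
  have hm1 : m ≤ 1 := by
    have : s * (2 * m - 1) ≤ s * 1 := by rw [hm, mul_one]; exact hsα
    have := le_of_mul_le_mul_left this hs0
    linarith
  have hint : Integrable (density m s : (Fin n → ℤ) × ℝ → ℝ) (refMeasure n) :=
    integrable_density hn (by omega) hαn hm
  set Z := ∫ p, density m s p ∂refMeasure n with hZ
  have hsupp : Function.support (density m s : (Fin n → ℤ) × ℝ → ℝ) = univ :=
    eq_univ_of_forall fun p => (density_pos m s p).ne'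
  have hIoc : ∀ x y, x < y → 0 < ∫ p in P ⁻¹' Ioc x y, density m s p ∂refMeasure n := by
    intro x y hxy
    rw [setIntegral_pos_iff_support_of_nonneg_ae (ae_of_all _ fun p => (density_pos m s p).le)
      hint.integrableOn, hsupp, univ_inter]
    exact hP.refMeasure_preimage_Ioc_pos hxy
  have hZ0 : 0 < Z := (hIoc 0 1 zero_lt_one).trans_le
    (setIntegral_le_integral hint (ae_of_all _ fun p => (density_pos m s p).le))
  let q : (Fin n → ℤ) × ℝ → ℝ := fun p => Z⁻¹ * density m s p
  have hq : Integrable q (refMeasure n) := hint.const_mul _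
  have hq0 : ∀ p, 0 ≤ q p := fun p => mul_nonneg (inv_nonneg.2 hZ0.le) (density_pos m s p).le
  have hq1 : ∫ p, q p ∂refMeasure n = 1 := by
    simp only [q, integral_const_mul]
    exact inv_mul_cancel₀ hZ0.ne'
  obtain ⟨H, hHmono, hH⟩ := exists_homeomorph_setIntegral hP.measurable hq hq0 hq1
    hP.refMeasure_preimage_singleton fun x y hxy => by
      simp only [q, integral_const_mul]
      exact mul_pos (inv_pos.2 hZ0) (hIoc x y hxy)
  have hfib : ∀ v t u, (H (P (v, t)) : ℝ) - H (P (v, u)) =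
      Z⁻¹ * ∫ x in u..t, density m s (v, x) := by
    have hle : ∀ v t u, u ≤ t → (H (P (v, t)) : ℝ) - H (P (v, u)) =
        Z⁻¹ * ∫ x in u..t, density m s (v, x) := by
      intro v t u hut
      rw [hH, hH, setIntegral_Ioc_preimage hP.measurable hq ((hP.strictMono v).monotone hut),
        hP.preimage_Ioc, setIntegral_refMeasure_singleton_prod hq v hut]
      simp only [q, intervalIntegral.integral_const_mul]
    intro v t u
    rcases le_total u t with h | h
    · exact hle v t u h
    · rw [intervalIntegral.integral_symm, mul_neg, ← hle v u t h]
      ring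
  refine ⟨(MulAut.conj H).toMonoidHom.comp φ, fun f => ?_, H, fun f x => ?_⟩
  swap
  · simp
  obtain ⟨K, hK, hbd⟩ := exists_spread_bounds hs f
  have hr : ∀ v : Fin n → ℤ, (1 : ℝ) ≤ level v := fun v => by exact_mod_cast one_le_level v
  have hr0 : ∀ v : Fin n → ℤ, (0 : ℝ) ≤ (level v : ℝ)⁻¹ := fun v => by positivity
  have hr1 : ∀ v : Fin n → ℤ, (level v : ℝ)⁻¹ ≤ 1 := fun v => inv_le_one_of_one_le₀ (hr v)
  -- G is the candidate derivative: the density ratio on the image of P and 1 elsewhere. The factor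
  -- Z^α converts unnormalized mass into distance in [0,1].
  obtain ⟨G, hG, hGpos, hGM⟩ := exists_holder_extension (α := α) (M := 250 * K ^ 10 * Z ^ α)
    (Y := fun p => H (P p))
    (D := fun p => densityRatio m (spread s p.1) (spread s (baseAct f p.1)) (shift f p.1) p.2)
    hα (by positivity) (H.injective.comp hP.injective)
    (fun v => hHmono.comp (hP.strictMono v))
    (fun v => by
      rw [Topology.IsEmbedding.subtypeVal.continuous_iff]
      have h : (Subtype.val ∘ fun t => H (P (v, t))) = fun t =>
          (H (P (v, 0)) : ℝ) + Z⁻¹ * ∫ x in (0 : ℝ)..t, density m s (v, x) := by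
        funext t
        rw [← hfib]
        simp
      rw [h]
      refine continuous_const.add (continuous_const.mul ?_)
      exact continuous_iff_continuousAt.2 fun t =>
        ((continuous_density m s v).integral_hasStrictDerivAt 0 t).hasDerivAt.continuousAt)
    (fun p => densityRatio_pos m (spread_pos s _) (spread_pos s _) _ _)
    (fun v t u => by
      refine (abs_densityRatio_sub_le hm0 hm1 hα hα1 hm (hr v) (spread_pos s _) hK (hbd v).1
        (hbd v).2.1 (hbd v).2.2 t u).trans (le_of_eq ?_)
      have h : |∫ x in u..t, (x ^ 2 + ((level v : ℝ) ^ s) ^ 2) ^ (-m)| =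
          Z * |(H (P (v, t)) : ℝ) - H (P (v, u))| := by
        rw [hfib, abs_mul, abs_of_pos (inv_pos.2 hZ0), mul_inv_cancel_left₀ hZ0.ne']
        rfl
      rw [h, Real.mul_rpow hZ0.le (abs_nonneg _)]
      ring)
    (fun v => tendsto_densityRatio hm0 hm1 (spread_pos s _) (spread_pos s _) hK (hr0 v) (hr1 v)
      (hbd v).1 (hbd v).2.1 (hbd v).2.2 tendsto_abs_atTop_atTop)
    (fun v => tendsto_densityRatio hm0 hm1 (spread_pos s _) (spread_pos s _) hK (hr0 v) (hr1 v)
      (hbd v).1 (hbd v).2.1 (hbd v).2.2 tendsto_abs_atBot_atTop)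
  refine isC1HolderDiffeo_conj hα hP.measurable hq hq0 hHmono hH (hφ.1 f) (fun x => ?_)
    (measurePreserving_skew f) (measurableEmbedding_skew f) (hPφ f) (fun p => ?_) hGpos hGM
  · simp
  · rw [hG]
    simp only [q, density_skew]
    ring

end Main

end FarbFranks

theorem theoremB (d : ℕ) (hd : 2 ≤ d) (α : ℝ) (hα : 0 < α)
    (hαd : α < 2 / ((d : ℝ) * ((d : ℝ) - 1))) :
    (∃ φ : lowerUnitriangular d →* (unitInterval ≃ₜ unitInterval),
      FarbFranks.IsFarbFranksAction d φ) ∧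
    ∀ φ : lowerUnitriangular d →* (unitInterval ≃ₜ unitInterval),
      FarbFranks.IsFarbFranksAction d φ →
      ∃ ψ : lowerUnitriangular d →* (unitInterval ≃ₜ unitInterval),
        (∀ f, FarbFranks.IsC1HolderDiffeo α (ψ f)) ∧ FarbFranks.TopConj φ ψ := by
  obtain ⟨n, rfl⟩ : ∃ n, d = n + 1 := ⟨d - 1, by omega⟩
  have hn : 1 ≤ n := by omega
  have hn' : (1 : ℝ) ≤ n := by exact_mod_cast hn
  refine ⟨FarbFranks.exists_isFarbFranksAction n, fun φ hφ =>
    hφ.exists_conj_isC1HolderDiffeo hn hα ?_⟩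
  -- With d = n + 1 the bound on α reads n(n + 1)/2 < 1/α.
  push_cast at hαd
  rw [lt_div_iff₀ (by nlinarith)] at hαd
  rw [lt_div_iff₀ hα]
  nlinarith
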